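/- Let $n\ge 5$, $q=2n+1$ and $\alpha=\binom n2$. For integers $c_2,\dots,c_{n-2}$ let $A\mathbb Z^n\subset\mathbb Z^n$ be the sublattice generated by $v=(0,\dots,0,1,2n-2)$, $v_1=(0,\dots,0,1,-3)$, $v_k=(0,\dots,0,1,\dots,1,c_k)$ with entries $1$ at the positions $k,\dots,n-1$ ($2\le k\le n-2$), and $v_{n-1}=(1,0,\dots,0,2)$, and let $\mathcal C\subseteq\mathbb Z_q^n$ be its reduction modulo $q$. Write $w_M(x)=\sum_i|x_i|$ for the Mannheim weight (representatives of least absolute value); the Lee sphere of radius $1$ around $y\in\mathbb Z_q^n$ is $\{x: w_M(x-y)\le 1\}$, a set of $q$ unit hypercubes of the $q^n$ hypercubic lattice $\mathbb Z_q^n$. Suppose that $\mathcal C$ is the classical single-error-correcting code, i.e. that the Lee spheres of radius $1$ around its elements (the codewords) tile $\mathbb Z_q^n$; this holds for $c_k\equiv 1-(n-k+1)^2 \pmod q$ (for which $c_{n-2}\equiv 2n-7$). (a) The $n$-dimensional toric quantum code on the cubulated torus $\mathbb Z_q^n/\mathcal C$ (qubits on the faces, i.e. two-dimensional cells; the operator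 $\sigma_x$ on the six faces of each three-dimensional cube and $\sigma_z$ on the faces containing each edge as stabilizer generators) has parameters $[[\alpha q,\alpha,d_M=3]]$: it has $\alpha q$ qubits, its dimension is $2^{\alpha}$, and $d_M=\min\{w_M(x):0\ne x\in\mathcal C\}=3$. It corrects every error on $t=\lfloor (d_M-1)/2\rfloor=1$ qubit. (b) There are $q^{n-1}$ codewords. Number them $0,\dots,q^{n-1}-1$, the codeword with number $m$ being $\sum_i m_i g_i$ with $m=\sum_i m_iq^i$, $0\le m_i<q$, and $(g_0,\dots,g_{n-2})=(v,v_2,\dots,v_{n-2},v_{n-1})$; those with $m_{n-2}=j$ are the codewords of the cross-section $j$ (first coordinate $j$), and they form $q$ consecutive blocks of $q^{n-3}$ codewords. The unit hypercube of each $x\in\mathbb Z_q^n$ carries the $\alpha$ faces of the lattice with corner $x$, one for each pair of coordinate directions, so that the lattice has $\alpha q^n$ faces. Interleaving: take one copy of the toric code for each codeword and order its $\alpha q$ qubits as $\alpha$ blocks of $q$ qubits; in each cross-section order the $q$ hypercubes of a Lee sphere of radius $1$ with the centre first; order the $\alpha$ faces of each hypercube (all these orders are otherwise arbitrary). The $s$-th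 qubit ($0\le s<q$) of the $a$-th block of the $u$-th codeword ($0\le u<q^{n-3}$) in the $b$-th block of the cross-section $j$ is placed on the $a$-th face of the $b$-th hypercube of the Lee sphere around the $(uq+s)$-th codeword of the cross-section $j$. This is a bijection from the qubits of all the copies to the faces of the $q^n$ hypercubic lattice, and the interleaved code has parameters $[[\alpha q^n,\alpha q^{n-1},t_i=q^2]]$: it has $\alpha q^n$ qubits and dimension $2^{\alpha q^{n-1}}$, and a single recovery operation corrects all errors located on a burst. Here a burst is a set of faces obtained by choosing, for every cross-section $j$, one Lee sphere of radius $1$ contained in the region of that cross-section (the union of the Lee spheres of radius $1$ around its codewords), and then taking at most one face from each hypercube of the chosen spheres; the largest bursts have exactly $q^2$ faces. -/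

import Mathlib

namespace ToricInterleaving

/-! ### Qubits, stabilizer codes, correctability -/

section Quantum

/-- The Pauli matrix `σ_x`. -/
def sigmaX : Matrix (Fin 2) (Fin 2) ℂ := !![0, 1; 1, 0]

/-- The Pauli matrix `σ_z`. -/
def sigmaZ : Matrix (Fin 2) (Fin 2) ℂ := !![1, 0; 0, -1]

variable {ι : Type} [Fintype ι] [DecidableEq ι]

/-- The tensor product of one-qubit operators `M i`, as an operator on the Hilbert space
`(ι → Fin 2) → ℂ` of the qubits labelled by `ι` (of dimension `2 ^ |ι|`). -/
def tensorOp (M : ι → Matrix (Fin 2) (Fin 2) ℂ) : Matrix (ι → Fin 2) (ι → Fin 2) ℂ :=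
  Matrix.of fun x y => ∏ i, M i (x i) (y i)

open Classical in
/-- `σ` on every qubit of `S`, the identity on the remaining qubits. -/
noncomputable def opOn (S : Set ι) (σ : Matrix (Fin 2) (Fin 2) ℂ) :
    Matrix (ι → Fin 2) (ι → Fin 2) ℂ :=
  tensorOp fun i => if i ∈ S then σ else 1

/-- The stabilizer code fixed by the operators `σ_x` on `S`, for `S ∈ xChecks`, and `σ_z` on `S`,
for `S ∈ zChecks`. -/
noncomputable def stabilizerCode (xChecks zChecks : Set (Set ι)) :
    Submodule ℂ ((ι → Fin 2) → ℂ) where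
  carrier := {ψ | (∀ S ∈ xChecks, (opOn S sigmaX).mulVec ψ = ψ) ∧
    ∀ S ∈ zChecks, (opOn S sigmaZ).mulVec ψ = ψ}
  add_mem' := by
    rintro a b ⟨ha, ha'⟩ ⟨hb, hb'⟩
    exact ⟨fun S hS => by rw [Matrix.mulVec_add, ha S hS, hb S hS],
      fun S hS => by rw [Matrix.mulVec_add, ha' S hS, hb' S hS]⟩
  zero_mem' := ⟨fun S _ => Matrix.mulVec_zero _, fun S _ => Matrix.mulVec_zero _⟩
  smul_mem' := by
    rintro r a ⟨ha, ha'⟩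
    exact ⟨fun S hS => by rw [Matrix.mulVec_smul, ha S hS],
      fun S hS => by rw [Matrix.mulVec_smul, ha' S hS]⟩

/-- All operators that act on the qubits of `T` only. -/
def errorsOn (T : Set ι) : Submodule ℂ (Matrix (ι → Fin 2) (ι → Fin 2) ℂ) :=
  Submodule.span ℂ {E | ∃ M : ι → Matrix (Fin 2) (Fin 2) ℂ, (∀ i, i ∉ T → M i = 1) ∧ E = tensorOp M}

/-- `code` corrects every error located on a set of qubits of the family `patterns`: one quantum
operation, with Kraus operators `R 0, …, R (m - 1)`, restores every code state after every such
error (each branch of the recovery returns a multiple of the original state, the factor being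
independent of the state). -/
def Corrects (code : Submodule ℂ ((ι → Fin 2) → ℂ)) (patterns : Set (Set ι)) : Prop :=
  ∃ (m : ℕ) (R : Fin m → Matrix (ι → Fin 2) (ι → Fin 2) ℂ),
    ∑ k, (R k).conjTranspose * R k = 1 ∧
    ∀ T ∈ patterns, ∀ E ∈ errorsOn T, ∀ k, ∃ r : ℂ, ∀ ψ ∈ code,
      (R k).mulVec (E.mulVec ψ) = r • ψ

end Quantum

/-! ### The hypercubic lattice and its lattice code -/

/-- The `q ^ n` hypercubic lattice `ℤ_q ^ n`, `q = 2 n + 1`; its points stand for the unit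
hypercubes. -/
abbrev Site (n : ℕ) : Type := Fin n → ZMod (2 * n + 1)

/-- The Mannheim weight `|x₁| + ⋯ + |xₙ|`, with the representatives of least absolute value. -/
def mannheimWeight {n : ℕ} (x : Site n) : ℕ := ∑ i, (x i).valMinAbs.natAbs

/-- The hypercubes of the Lee sphere of radius 1 around `0`. -/
abbrev LeeSphere (n : ℕ) : Type := {x : Site n // mannheimWeight x ≤ 1}

/-- `v = (0, …, 0, 1, 2 n - 2)`. -/
def vFirst (n : ℕ) : Fin n → ℤ := fun i =>
  if (i : ℕ) + 2 = n then 1 else if (i : ℕ) + 1 = n then 2 * n - 2 else 0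

/-- `v₁ = (0, …, 0, 1, -3)`. -/
def vOne (n : ℕ) : Fin n → ℤ := fun i =>
  if (i : ℕ) + 2 = n then 1 else if (i : ℕ) + 1 = n then -3 else 0

/-- `v_k = (0, …, 0, 1, …, 1, c k)`, with entries `1` at the positions `k, …, n - 1` (positions are
counted from `1`), for `2 ≤ k ≤ n - 2`. -/
def vMid (n : ℕ) (c : ℕ → ℤ) (k : ℕ) : Fin n → ℤ := fun i =>
  if (i : ℕ) + 1 = n then c k else if k ≤ (i : ℕ) + 1 then 1 else 0

/-- `v_{n-1} = (1, 0, …, 0, 2)`. -/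
def vLast (n : ℕ) : Fin n → ℤ := fun i =>
  if (i : ℕ) = 0 then 1 else if (i : ℕ) + 1 = n then 2 else 0

/-- The sublattice `A ℤ ^ n` of `ℤ ^ n` generated by `v, v₁, v₂, …, v_{n-1}`. -/
def sublattice (n : ℕ) (c : ℕ → ℤ) : AddSubgroup (Fin n → ℤ) :=
  AddSubgroup.closure
    ({vFirst n, vOne n, vLast n} ∪ {w | ∃ k, 2 ≤ k ∧ k + 2 ≤ n ∧ w = vMid n c k})

/-- Reduction modulo `q`. -/
def reduce (n : ℕ) : (Fin n → ℤ) →+ Site n where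
  toFun x := fun i => (x i : ZMod (2 * n + 1))
  map_zero' := by ext i; simp
  map_add' x y := by ext i; simp

/-- The lattice code `A ℤ ^ n / q ℤ ^ n`: the codewords in the hypercubic lattice. -/
def latticeCode (n : ℕ) (c : ℕ → ℤ) : AddSubgroup (Site n) := (sublattice n c).map (reduce n)

/-- The Lee spheres of radius 1 around the codewords are a close packing of the hypercubic lattice:
the code is the (perfect) classical single-error-correcting code. -/
def IsClosePacking (n : ℕ) (c : ℕ → ℤ) : Prop :=
  ∀ x : Site n, ∃! w, w ∈ latticeCode n c ∧ mannheimWeight (x - w) ≤ 1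

/-- The last coordinates `1 - (n - k + 1) ^ 2 (mod q)`; for `k = n - 2` this is `2 n - 7`. -/
def standardLast (n : ℕ) (k : ℕ) : ℤ := (1 - ((n : ℤ) - k + 1) ^ 2) % (2 * n + 1)

/-- The generators in the order in which the codewords are enumerated:
`v, v₂, v₃, …, v_{n-2}, v_{n-1}`. -/
def gen (n : ℕ) (c : ℕ → ℤ) (k : ℕ) : Fin n → ℤ :=
  if k = 0 then vFirst n else if k + 2 = n then vLast n else vMid n c (k + 1)

/-- The codeword number `m`: the base `q` digits of `m` are the coefficients of the generators.
The cross-section number `j` holds the numbers `j q ^ (n - 2), …, (j + 1) q ^ (n - 2) - 1`. -/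
def codeword (n : ℕ) (c : ℕ → ℤ) (m : ℕ) : Site n :=
  reduce n (∑ k ∈ Finset.range (n - 1), (m / (2 * n + 1) ^ k % (2 * n + 1)) • gen n c k)

/-! ### Cells and the toric quantum code -/

/-- Sets of `k` coordinate directions. -/
abbrev Dirs (n k : ℕ) : Type := {D : Finset (Fin n) // D.card = k}

/-- The faces of the hypercubic lattice, `C(n,2)` for every unit hypercube. -/
abbrev LatticeFace (n : ℕ) : Type := Site n × Dirs n 2

/-- The vertices of the torus `ℤ ^ n / A ℤ ^ n`. -/
def TorusVertex (n : ℕ) (c : ℕ → ℤ) : Type := Site n ⧸ latticeCode n c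

noncomputable instance (n : ℕ) (c : ℕ → ℤ) : AddCommGroup (TorusVertex n c) :=
  inferInstanceAs (AddCommGroup (Site n ⧸ latticeCode n c))

noncomputable instance (n : ℕ) (c : ℕ → ℤ) : Fintype (TorusVertex n c) :=
  haveI : Finite (TorusVertex n c) := inferInstanceAs (Finite (Site n ⧸ latticeCode n c))
  Fintype.ofFinite _

noncomputable instance (n : ℕ) (c : ℕ → ℤ) : DecidableEq (TorusVertex n c) := Classical.decEq _

/-- The `k`-dimensional cells of the cubulation of the torus: `(x, D)` is the cube with corner `x`
that is spanned by the directions of `D`. -/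
abbrev TorusCell (n : ℕ) (c : ℕ → ℤ) (k : ℕ) : Type := TorusVertex n c × Dirs n k

/-- The class of a site in the torus. -/
def toTorus (n : ℕ) (c : ℕ → ℤ) (x : Site n) : TorusVertex n c :=
  QuotientAddGroup.mk (s := latticeCode n c) x

/-- `f` is one of the facets `(x, D \ {i})`, `(x + e_i, D \ {i})`, `i ∈ D`, of the cube
`g = (x, D)`. -/
def IsFacet {n : ℕ} {c : ℕ → ℤ} {k l : ℕ} (f : TorusCell n c k) (g : TorusCell n c l) : Prop :=
  ∃ i ∈ g.2.1, f.2.1 = g.2.1.erase i ∧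
    (f.1 = g.1 ∨ f.1 = g.1 + toTorus n c (Pi.single i 1))

/-- The six faces of a three-dimensional cube. -/
def cubeCheck {n : ℕ} {c : ℕ → ℤ} (g : TorusCell n c 3) : Set (TorusCell n c 2) :=
  {f | IsFacet f g}

/-- The faces that contain an edge. -/
def edgeCheck {n : ℕ} {c : ℕ → ℤ} (e : TorusCell n c 1) : Set (TorusCell n c 2) :=
  {f | IsFacet e f}

/-- The `n`-dimensional toric quantum code: qubits on the faces of the torus, `X`-parity checks on
cubes, `Z`-parity checks on edges. -/
noncomputable def toricCode (n : ℕ) (c : ℕ → ℤ) :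
    Submodule ℂ ((TorusCell n c 2 → Fin 2) → ℂ) :=
  stabilizerCode (Set.range cubeCheck) (Set.range edgeCheck)

/-! ### Interleaving -/

/-- The choices that the interleaving method leaves free. -/
structure Interleaving (n : ℕ) (c : ℕ → ℤ) where
  /-- for each codeword, the order of its `C(n,2) q` qubits: `C(n,2)` blocks of `q` qubits -/
  qubit : Fin ((2 * n + 1) ^ (n - 1)) → (Fin (n.choose 2) × Fin (2 * n + 1) ≃ TorusCell n c 2)
  /-- for each cross-section, the order in which the hypercubes of a Lee sphere are used -/
  cube : Fin (2 * n + 1) → (Fin (2 * n + 1) ≃ LeeSphere n)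
  /-- the central hypercube comes first -/
  cube_zero : ∀ j, (cube j 0).1 = 0
  /-- for each hypercube, the order of its faces -/
  face : Site n → (Fin (n.choose 2) ≃ Dirs n 2)

/-- Where the qubit `f` of the codeword number `m` goes. Let `m` be in the cross-section `j`, in the
block `b` among the `q` blocks of `q ^ (n - 3)` codewords of this cross-section, at the place `u` of
this block, and let `f` be the qubit number `s` of the block number `a` of `q` qubits of the codeword.
It is put on the face number `a` of the hypercube number `b` of the Lee sphere of the codeword
number `u q + s` of the cross-section `j`. -/
def Interleaving.place {n : ℕ} {c : ℕ → ℤ} (I : Interleaving n c)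
    (p : Fin ((2 * n + 1) ^ (n - 1)) × TorusCell n c 2) : LatticeFace n :=
  let q := 2 * n + 1
  let m : ℕ := p.1
  let a := ((I.qubit p.1).symm p.2).1
  let s := ((I.qubit p.1).symm p.2).2
  let j := m / q ^ (n - 2)
  let b := m % q ^ (n - 2) / q ^ (n - 3)
  let u := m % q ^ (n - 2) % q ^ (n - 3)
  let x : Site n := codeword n c (j * q ^ (n - 2) + (u * q + s)) +
    (I.cube (Fin.ofNat q j) (Fin.ofNat q b)).1
  (x, I.face x a)

/-- The interleaved code, on the faces of the hypercubic lattice: one toric quantum code for each of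
the `q ^ (n - 1)` codewords, its qubits moved to their places. -/
noncomputable def Interleaving.code {n : ℕ} {c : ℕ → ℤ} (I : Interleaving n c) :
    Submodule ℂ ((LatticeFace n → Fin 2) → ℂ) :=
  stabilizerCode {S | ∃ m g, S = (fun f => I.place (m, f)) '' cubeCheck g}
    {S | ∃ m e, S = (fun f => I.place (m, f)) '' edgeCheck e}

/-- The region of the cross-section `j`: the Lee spheres of radius 1 of the codewords with first
coordinate `j`. -/
def sectionRegion (n : ℕ) (c : ℕ → ℤ) (j : ZMod (2 * n + 1)) : Set (Site n) :=
  {x | ∃ w ∈ latticeCode n c, (∀ i : Fin n, (i : ℕ) = 0 → w i = j) ∧ mannheimWeight (x - w) ≤ 1}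

/-- `T` is a set of erroneous qubits that forms at most one cluster in each cross-section, every
cluster having the shape of a Lee sphere of radius 1: at most one erroneous qubit in each hypercube
of the sphere. -/
def IsBurst (n : ℕ) (c : ℕ → ℤ) (T : Set (LatticeFace n)) : Prop :=
  ∃ center : ZMod (2 * n + 1) → Site n,
    (∀ j x, mannheimWeight (x - center j) ≤ 1 → x ∈ sectionRegion n c j) ∧
    (∀ f ∈ T, ∃ j, mannheimWeight (f.1 - center j) ≤ 1) ∧
    ∀ f ∈ T, ∀ g ∈ T, f.1 = g.1 → f = g

end ToricInterleaving

open ToricInterleaving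

/-!
Three independent facts carry the proof.

*Lattice code.* Modulo `q = 2 n + 1` the generators span the kernel of a linear functional `dual`
on `ℤ_q ^ n` (`mem_latticeCode_iff`): the last coordinate of a codeword is a linear function of the
other ones, which are arbitrary. So the torus has a cyclic group of `q` vertices, and the Lee
spheres of radius 1 tile exactly when `dual` is a bijection from a Lee sphere to `ℤ_q`
(`isClosePacking_iff`). For the standard lattice the coefficients of `dual` are `2, 4, …, 2 n`, and
with their negatives and `0` these exhaust `ℤ_q`.

*Toric code.* A state that is fixed by the checks is a function on the `𝔽₂`-cycles that is constant
modulo boundaries, so the dimension of the code is the order of the second homology group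
(`IsHomology.finrank_eq`). The chain complex of the torus is a Koszul complex over the group ring
`𝔽₂[ℤ_q]`. As `q` is odd, this ring splits into the constants, where all the differentials vanish
(which gives one class for every pair of directions), and the elements of vanishing sum, where
`1 + S` with `S` the shift in the last direction is invertible, so that this part is exact
(`boundary_filling`, `isHomology_toric`). Errors are corrected by measuring the `Z`-checks, undoing
the bit flips, and then doing the same with the `X`-checks after a Hadamard transform
(`corrects_of_syndrome`). This needs only that the errors are determined by their syndromes, and a
face is determined by its edges, and also by the cubes around it (`eq_of_edgeCheck_iff`,
`eq_of_cubeCheck_iff`).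

*Interleaving.* Every hypercube is in the Lee sphere of one codeword, so its place determines the
qubit (`Interleaving.place_bijective`), and the interleaved code is a family of toric codes on
disjoint sets of qubits. A Lee sphere contained in the region of a cross-section is centred at a
codeword (`center_mem`), and the qubits of one copy that are in the same Lee sphere are all in the
same hypercube. Hence a burst has at most one error in each copy (`IsBurst.subsingleton`), and every
copy can correct it.
-/

namespace ToricInterleaving

set_option linter.unusedSectionVars false

/-! ### Pauli operators -/

section Pauli

variable {ι : Type}

/-- The indicator vector of `S` over `𝔽₂ = Fin 2`. -/
noncomputable def ind (S : Set ι) : ι → Fin 2 := S.indicator 1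

variable [Fintype ι]

/-- The parity of `x` on `S`, as an additive map. -/
noncomputable def parity (S : Set ι) : (ι → Fin 2) →+ Fin 2 where
  toFun x := ∑ i, S.indicator x i
  map_zero' := by simp
  map_add' x y := by simp [Set.indicator_add', Finset.sum_add_distrib]

lemma parity_apply (S : Set ι) (x : ι → Fin 2) : parity S x = ∑ i, S.indicator x i := rfl

/-- The character `t ↦ (-1) ^ t` of `𝔽₂`. -/
def sgn (t : Fin 2) : ℂ := if t = 0 then 1 else -1

lemma sgn_add (a b : Fin 2) : sgn (a + b) = sgn a * sgn b := by
  fin_cases a <;> fin_cases b <;> simp [sgn]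

lemma sgn_zero : sgn 0 = 1 := by simp [sgn]

lemma sgn_eq_one {a : Fin 2} : sgn a = 1 ↔ a = 0 := by
  fin_cases a
  · simp [sgn]
  · simp only [sgn]; norm_num

lemma sgn_sum {κ : Type*} (s : Finset κ) (f : κ → Fin 2) :
    sgn (∑ i ∈ s, f i) = ∏ i ∈ s, sgn (f i) := by
  classical
  induction s using Finset.induction_on with
  | empty => simp [sgn_zero]
  | insert a s ha ih => rw [Finset.sum_insert ha, Finset.prod_insert ha, sgn_add, ih]

lemma add_self_fin (a : Fin 2) : a + a = 0 := by fin_cases a <;> rfl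

variable [DecidableEq ι]

lemma tensorOp_mul (M N : ι → Matrix (Fin 2) (Fin 2) ℂ) :
    tensorOp M * tensorOp N = tensorOp fun i => M i * N i := by
  ext x y
  simp only [Matrix.mul_apply, tensorOp, Matrix.of_apply]
  rw [Finset.prod_univ_sum, Fintype.piFinset_univ]
  simp only [Finset.prod_mul_distrib]

lemma tensorOp_one : tensorOp (fun _ : ι => (1 : Matrix (Fin 2) (Fin 2) ℂ)) = 1 := by
  classical
  ext x y
  simp only [tensorOp, Matrix.of_apply, Matrix.one_apply, Finset.prod_ite_zero]
  simp [funext_iff]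

lemma tensorOp_conjTranspose (M : ι → Matrix (Fin 2) (Fin 2) ℂ) :
    (tensorOp M).conjTranspose = tensorOp fun i => (M i).conjTranspose := by
  ext x y
  simp [tensorOp, Matrix.conjTranspose_apply]

lemma opOn_sigmaX_mulVec (S : Set ι) (ψ : (ι → Fin 2) → ℂ) :
    (opOn S sigmaX).mulVec ψ = fun x => ψ (x + ind S) := by
  classical
  ext x
  have key : ∀ y, opOn S sigmaX x y = if y = x + ind S then 1 else 0 := by
    intro y
    have : ∀ i, (if i ∈ S then sigmaX else 1) (x i) (y i)
        = if y i = x i + ind S i then (1 : ℂ) else 0 := by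
      intro i
      by_cases h : i ∈ S
      · simp only [h, if_true, ind, Set.indicator_of_mem, Pi.one_apply, sigmaX]
        generalize x i = a
        generalize y i = b
        fin_cases a <;> fin_cases b <;> simp
      · simp [h, ind, Matrix.one_apply, eq_comm]
    simp only [opOn, tensorOp, Matrix.of_apply]
    rw [Finset.prod_congr rfl fun i _ => this i, Finset.prod_ite_zero]
    simp [funext_iff]
  simp [Matrix.mulVec, dotProduct, key]

lemma opOn_sigmaZ (S : Set ι) :
    opOn S sigmaZ = Matrix.diagonal fun x => sgn (parity S x) := by
  classical
  ext x y
  have : ∀ i, (if i ∈ S then sigmaZ else 1) (x i) (y i)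
      = if x i = y i then sgn (S.indicator x i) else 0 := by
    intro i
    by_cases h : i ∈ S
    · simp only [h, if_true, Set.indicator_of_mem, sigmaZ, sgn]
      generalize x i = a
      generalize y i = b
      fin_cases a <;> fin_cases b <;> simp
    · simp [h, Matrix.one_apply, sgn]
  simp only [opOn, tensorOp, Matrix.of_apply, parity_apply, sgn_sum, Matrix.diagonal_apply]
  rw [Finset.prod_congr rfl fun i _ => this i, Finset.prod_ite_zero]
  simp [funext_iff]

lemma opOn_sigmaZ_mulVec (S : Set ι) (ψ : (ι → Fin 2) → ℂ) :
    (opOn S sigmaZ).mulVec ψ = fun x => sgn (parity S x) * ψ x := by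
  ext x
  rw [opOn_sigmaZ, Matrix.mulVec_diagonal]

lemma opOn_mul (S : Set ι) (σ τ : Matrix (Fin 2) (Fin 2) ℂ) :
    opOn S σ * opOn S τ = opOn S (σ * τ) := by
  unfold opOn
  rw [tensorOp_mul]
  congr 1
  ext1 i
  split_ifs <;> simp

lemma opOn_sigmaX_sq (S : Set ι) : opOn S sigmaX * opOn S sigmaX = 1 := by
  rw [opOn_mul, ← tensorOp_one]
  unfold opOn
  congr 1
  ext1 i
  have : sigmaX * sigmaX = 1 := by
    ext a b; fin_cases a <;> fin_cases b <;> simp [sigmaX]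
  simp [this]

lemma opOn_sigmaX_conjTranspose (S : Set ι) :
    (opOn S sigmaX).conjTranspose = opOn S sigmaX := by
  unfold opOn
  rw [tensorOp_conjTranspose]
  congr 1
  ext1 i
  have : sigmaX.conjTranspose = sigmaX := by
    ext a b; fin_cases a <;> fin_cases b <;> simp [sigmaX]
  split_ifs <;> simp [this]

/-- The Hadamard gate, exchanging `σ_x` and `σ_z`. -/
noncomputable def hadamard : Matrix (Fin 2) (Fin 2) ℂ :=
  ((Real.sqrt 2 : ℂ)⁻¹) • !![1, 1; 1, -1]

/-- The Hadamard transform of all qubits. -/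
noncomputable def fourier (ι : Type) [Fintype ι] : Matrix (ι → Fin 2) (ι → Fin 2) ℂ :=
  tensorOp fun _ => hadamard

lemma hadamard_sq : hadamard * hadamard = 1 := by
  have h2 : (Real.sqrt 2 : ℂ)⁻¹ * (Real.sqrt 2 : ℂ)⁻¹ = 2⁻¹ := by
    rw [← Complex.ofReal_inv, ← Complex.ofReal_mul, ← mul_inv, Real.mul_self_sqrt (by norm_num)]
    simp
  rw [hadamard, Matrix.smul_mul, Matrix.mul_smul, smul_smul, h2]
  ext a b
  fin_cases a <;> fin_cases b <;> simp <;> norm_num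

lemma hadamard_conjTranspose : hadamard.conjTranspose = hadamard := by
  ext a b
  fin_cases a <;> fin_cases b <;> simp [hadamard]

lemma hadamard_sigmaX : hadamard * sigmaX = sigmaZ * hadamard := by
  ext a b
  fin_cases a <;> fin_cases b <;> simp [hadamard, sigmaX, sigmaZ]

lemma fourier_sq : fourier ι * fourier ι = 1 := by
  rw [fourier, tensorOp_mul, hadamard_sq, tensorOp_one]

lemma fourier_conjTranspose : (fourier ι).conjTranspose = fourier ι := by
  rw [fourier, tensorOp_conjTranspose, hadamard_conjTranspose]

lemma fourier_sigmaX (S : Set ι) : fourier ι * opOn S sigmaX = opOn S sigmaZ * fourier ι := by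
  unfold fourier opOn
  rw [tensorOp_mul, tensorOp_mul]
  congr 1
  ext1 i
  split_ifs <;> simp [hadamard_sigmaX]

lemma fourier_sigmaZ (S : Set ι) : fourier ι * opOn S sigmaZ = opOn S sigmaX * fourier ι := by
  have h := congrArg (fun A => fourier ι * A * fourier ι) (fourier_sigmaX S)
  simp only [← mul_assoc, fourier_sq, one_mul] at h
  rw [mul_assoc _ _ (fourier ι), fourier_sq, mul_one] at h
  exact h.symm

/-- Every one-qubit operator is a combination of `1, σ_x, σ_z, σ_x σ_z`. -/
lemma exists_pauli_coeff (M : Matrix (Fin 2) (Fin 2) ℂ) : ∃ a : Fin 2 × Fin 2 → ℂ,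
    M = ∑ p, a p • ((if p.1 = 0 then 1 else sigmaX) * (if p.2 = 0 then 1 else sigmaZ)) := by
  refine ⟨fun p => if p.1 = 0 then (if p.2 = 0 then (M 0 0 + M 1 1) / 2 else (M 0 0 - M 1 1) / 2)
    else (if p.2 = 0 then (M 0 1 + M 1 0) / 2 else (M 1 0 - M 0 1) / 2), ?_⟩
  ext a b
  rw [Fintype.sum_prod_type]
  fin_cases a <;> fin_cases b <;> simp [sigmaX, sigmaZ] <;> ring

/-- Operators on the qubits of `T` are combinations of Pauli operators on `T`. -/
lemma errorsOn_le_span_pauli (T : Set ι) : errorsOn T ≤ Submodule.span ℂ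
    {E | ∃ A B : Set ι, A ⊆ T ∧ B ⊆ T ∧ E = opOn A sigmaX * opOn B sigmaZ} := by
  classical
  refine Submodule.span_le.2 ?_
  rintro _ ⟨M, hM, rfl⟩
  have : ∀ i, ∃ a : Fin 2 × Fin 2 → ℂ, (i ∉ T → ∀ p, p ≠ 0 → a p = 0) ∧
      M i = ∑ p, a p • ((if p.1 = 0 then 1 else sigmaX) * (if p.2 = 0 then 1 else sigmaZ)) := by
    intro i
    by_cases hi : i ∈ T
    · obtain ⟨a, ha⟩ := exists_pauli_coeff (M i)
      exact ⟨a, fun h => absurd hi h, ha⟩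
    · refine ⟨fun p => if p = 0 then 1 else 0, fun _ p hp => by simp [hp], ?_⟩
      rw [hM i hi, Finset.sum_eq_single 0 (fun p _ hp => by simp [hp]) (by simp)]
      simp
  choose a ha hMa using this
  have hexp : tensorOp M = ∑ p : ι → Fin 2 × Fin 2, (∏ i, a i (p i)) •
      (opOn {i | (p i).1 ≠ 0} sigmaX * opOn {i | (p i).2 ≠ 0} sigmaZ) := by
    ext x y
    simp only [opOn, tensorOp_mul]
    simp only [tensorOp, Matrix.of_apply, Matrix.sum_apply, Matrix.smul_apply, smul_eq_mul]
    rw [Finset.prod_congr rfl fun i _ => congrFun (congrFun (hMa i) (x i)) (y i)]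
    simp only [Matrix.sum_apply, Matrix.smul_apply, smul_eq_mul]
    rw [Finset.prod_univ_sum, Fintype.piFinset_univ]
    simp only [Finset.prod_mul_distrib]
    refine Finset.sum_congr rfl fun p _ => ?_
    congr 1
    refine Finset.prod_congr rfl fun i _ => ?_
    by_cases h1 : (p i).1 = 0 <;> by_cases h2 : (p i).2 = 0 <;> simp [h1, h2]
  rw [hexp]
  refine Submodule.sum_mem _ fun p _ => ?_
  by_cases hp : ∀ i ∉ T, p i = 0
  · refine Submodule.smul_mem _ _ (Submodule.subset_span ⟨_, _, ?_, ?_, rfl⟩)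
    all_goals
      intro i hi
      by_contra hiT
      simp [hp i hiT] at hi
  · push Not at hp
    obtain ⟨i, hi, hpi⟩ := hp
    rw [Finset.prod_eq_zero (Finset.mem_univ i) (ha i hi _ hpi), zero_smul]
    exact Submodule.zero_mem _

end Pauli

/-! ### Dimension and error correction of stabilizer codes with `X`- and `Z`-checks -/

section CSS

variable {ι : Type} [Fintype ι] [DecidableEq ι]

lemma mem_stabilizerCode {X Z : Set (Set ι)} {ψ : (ι → Fin 2) → ℂ} :
    ψ ∈ stabilizerCode X Z ↔ (∀ S ∈ X, ∀ x, ψ (x + ind S) = ψ x) ∧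
      ∀ x, ψ x ≠ 0 → ∀ S ∈ Z, parity S x = 0 := by
  change ((∀ S ∈ X, (opOn S sigmaX).mulVec ψ = ψ) ∧
    ∀ S ∈ Z, (opOn S sigmaZ).mulVec ψ = ψ) ↔ _
  simp only [opOn_sigmaX_mulVec, opOn_sigmaZ_mulVec, funext_iff]
  refine and_congr_right fun _ => ⟨fun h x hx S hS => ?_, fun h S hS x => ?_⟩
  · exact sgn_eq_one.1 (mul_right_cancel₀ hx ((h S hS x).trans (one_mul _).symm))
  · by_cases hx : ψ x = 0
    · simp [hx]
    · rw [h x hx S hS, sgn_zero, one_mul]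

/-- `π` identifies the `Z`-cycles (the vectors of even parity on all the checks in `Z`) modulo the
`X`-boundaries (the sums of checks in `X`) with `H`. In particular boundaries are cycles. -/
structure IsHomology (X Z : Set (Set ι)) {H : Type*} [AddCommGroup H]
    (π : (ι → Fin 2) →+ H) : Prop where
  even : ∀ S ∈ X, ∀ S' ∈ Z, parity S' (ind S) = 0
  vanish : ∀ S ∈ X, π (ind S) = 0
  surj : ∀ h, ∃ x, (∀ S ∈ Z, parity S x = 0) ∧ π x = h
  exact : ∀ x, (∀ S ∈ Z, parity S x = 0) → π x = 0 → x ∈ AddSubgroup.closure (ind '' X)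

/-- The code states are the functions on the homology group: the dimension of the code is the order
of the group. -/
theorem IsHomology.finrank_eq {X Z : Set (Set ι)} {H : Type*} [AddCommGroup H] [Fintype H]
    {π : (ι → Fin 2) →+ H} (h : IsHomology X Z π) :
    Module.finrank ℂ (stabilizerCode X Z) = Fintype.card H := by
  classical
  let L : (H → ℂ) →ₗ[ℂ] ((ι → Fin 2) → ℂ) :=
    { toFun := fun φ x => if ∀ S ∈ Z, parity S x = 0 then φ (π x) else 0
      map_add' := fun a b => by ext x; simp only [Pi.add_apply]; split_ifs <;> simp
      map_smul' := fun r a => by ext x; simp }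
  have hL : ∀ φ x, (∀ S ∈ Z, parity S x = 0) → L φ x = φ (π x) := fun φ x hx => if_pos hx
  have hL' : ∀ φ x, ¬ (∀ S ∈ Z, parity S x = 0) → L φ x = 0 := fun φ x hx => if_neg hx
  have hinj : Function.Injective L := by
    intro φ φ' hφ
    ext t
    obtain ⟨x, hx, rfl⟩ := h.surj t
    rw [← hL φ x hx, hφ, hL φ' x hx]
  have hrange : L.range = stabilizerCode X Z := by
    ext ψ
    rw [mem_stabilizerCode]
    constructor
    · rintro ⟨φ, rfl⟩
      refine ⟨fun S hS x => ?_, fun x hx => ?_⟩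
      · have hiff : (∀ S' ∈ Z, parity S' (x + ind S) = 0) ↔ ∀ S' ∈ Z, parity S' x = 0 :=
          forall₂_congr fun S' hS' => by rw [map_add, h.even S hS S' hS', add_zero]
        by_cases hx : ∀ S' ∈ Z, parity S' x = 0
        · rw [hL _ _ hx, hL _ _ (hiff.2 hx), map_add, h.vanish S hS, add_zero]
        · rw [hL' _ _ hx, hL' _ _ (mt hiff.1 hx)]
      · by_contra hx'
        exact hx (hL' _ _ hx')
    · rintro ⟨hX, hZ⟩
      have hU : ∀ u ∈ AddSubgroup.closure (ind '' X), ∀ x, ψ (x + u) = ψ x := by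
        intro u hu
        induction hu using AddSubgroup.closure_induction with
        | mem u hu => obtain ⟨S, hS, rfl⟩ := hu; exact hX S hS
        | zero => simp
        | add u v _ _ hu hv => intro x; rw [← add_assoc, hv, hu]
        | neg u _ hu => intro x; rw [← hu (x + -u)]; simp
      choose y hy hy' using h.surj
      refine ⟨fun t => ψ (y t), ?_⟩
      ext x
      by_cases hx : ∀ S ∈ Z, parity S x = 0
      · rw [hL _ _ hx]
        have := hU _ (h.exact (x - y (π x))
          (fun S hS => by rw [map_sub, hx S hS, hy _ S hS, sub_zero])
          (by rw [map_sub, hy', sub_self])) (y (π x))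
        rw [← this, add_sub_cancel]
      · rw [hL' _ _ hx]
        by_contra hne
        exact hx (hZ x (Ne.symm hne))
  rw [← hrange, LinearMap.finrank_range_of_inj hinj, Module.finrank_fintype_fun_eq_card]

/-- The syndrome of `x` with respect to the checks in `Z`. -/
noncomputable def syndrome (Z : Set (Set ι)) (x : ι → Fin 2) : Z → Fin 2 := fun S => parity S.1 x

open Classical in
/-- Project on the states of syndrome `s`, then flip the qubits of the set `d s`. -/
noncomputable def decodeStep (Z : Set (Set ι)) (d : (Z → Fin 2) → Set ι) (s : Z → Fin 2) :
    Matrix (ι → Fin 2) (ι → Fin 2) ℂ :=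
  opOn (d s) sigmaX * Matrix.diagonal fun x => if syndrome Z x = s then 1 else 0

lemma sum_decodeStep (Z : Set (Set ι)) [Fintype (Z → Fin 2)] (d : (Z → Fin 2) → Set ι) :
    ∑ s, (decodeStep Z d s).conjTranspose * decodeStep Z d s = 1 := by
  classical
  have : ∀ s, (decodeStep Z d s).conjTranspose * decodeStep Z d s =
      Matrix.diagonal fun x => if syndrome Z x = s then 1 else 0 := by
    intro s
    rw [decodeStep, Matrix.conjTranspose_mul, opOn_sigmaX_conjTranspose, mul_assoc,
      ← mul_assoc (opOn _ _) (opOn _ _), opOn_sigmaX_sq, one_mul, Matrix.diagonal_conjTranspose,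
      Matrix.diagonal_mul_diagonal]
    congr 1
    ext x
    simp
  ext x y
  simp only [this, Matrix.sum_apply, Matrix.diagonal_apply, Matrix.one_apply]
  split_ifs <;> simp

open Classical in
lemma decodeStep_mulVec {Z : Set (Set ι)} {d : (Z → Fin 2) → Set ι} {A : Set ι}
    (hd : d (syndrome Z (ind A)) = A) {φ : (ι → Fin 2) → ℂ}
    (hφ : ∀ x, φ x ≠ 0 → ∀ S ∈ Z, parity S x = 0) (s : Z → Fin 2) :
    (decodeStep Z d s).mulVec ((opOn A sigmaX).mulVec φ) =
      (if s = syndrome Z (ind A) then (1 : ℂ) else 0) • φ := by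
  have hproj : (Matrix.diagonal fun x => if syndrome Z x = s then (1 : ℂ) else 0).mulVec
      ((opOn A sigmaX).mulVec φ) =
      (if s = syndrome Z (ind A) then (1 : ℂ) else 0) • (opOn A sigmaX).mulVec φ := by
    ext x
    rw [Matrix.mulVec_diagonal, opOn_sigmaX_mulVec, Pi.smul_apply, smul_eq_mul]
    by_cases hx : φ (x + ind A) = 0
    · simp [hx]
    · have : syndrome Z x = syndrome Z (ind A) := by
        ext S : 1
        have h := hφ _ hx S.1 S.2
        rw [map_add] at h
        simp only [syndrome]
        generalize parity S.1 x = a at h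
        generalize parity S.1 (ind A) = b at h
        revert a b; decide
      rw [this]
      congr 1
      simp only [eq_comm]
  rw [decodeStep, ← Matrix.mulVec_mulVec, hproj, Matrix.mulVec_smul]
  split_ifs with hs
  · rw [hs, hd, Matrix.mulVec_mulVec, opOn_sigmaX_sq, Matrix.one_mulVec]
  · simp only [zero_smul]

/-- A code with `X`- and `Z`-checks corrects the errors located on the given patterns if a subset of
a pattern is determined by its parities with the `Z`-checks, and also by its parities with the
`X`-checks: the recovery undoes the bit flips, and then the phase flips, after conjugation with the
Hadamard transform. -/
theorem corrects_of_syndrome {X Z : Set (Set ι)} {patterns : Set (Set ι)}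
    (hZ : ∀ T ∈ patterns, ∀ T' ∈ patterns, ∀ A ⊆ T, ∀ A' ⊆ T',
      (∀ S ∈ Z, parity S (ind A) = parity S (ind A')) → A = A')
    (hX : ∀ T ∈ patterns, ∀ T' ∈ patterns, ∀ A ⊆ T, ∀ A' ⊆ T',
      (∀ S ∈ X, parity S (ind A) = parity S (ind A')) → A = A') :
    Corrects (stabilizerCode X Z) patterns := by
  classical
  have hdec : ∀ W : Set (Set ι), (∀ T ∈ patterns, ∀ T' ∈ patterns, ∀ A ⊆ T, ∀ A' ⊆ T',
      (∀ S ∈ W, parity S (ind A) = parity S (ind A')) → A = A') →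
      ∃ d : (W → Fin 2) → Set ι, ∀ T ∈ patterns, ∀ A ⊆ T, d (syndrome W (ind A)) = A := by
    intro W hW
    have hinj : Set.InjOn (fun A => syndrome W (ind A)) {A | ∃ T ∈ patterns, A ⊆ T} := by
      rintro A ⟨T, hT, hA⟩ A' ⟨T', hT', hA'⟩ h
      exact hW T hT T' hT' A hA A' hA' fun S hS => congrFun h ⟨S, hS⟩
    exact ⟨Function.invFunOn (fun A => syndrome W (ind A)) {A | ∃ T ∈ patterns, A ⊆ T},
      fun T hT A hA => hinj.leftInvOn_invFunOn ⟨T, hT, hA⟩⟩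
  obtain ⟨dZ, hdZ⟩ := hdec Z hZ
  obtain ⟨dX, hdX⟩ := hdec X hX
  let F := fourier ι
  let R : (Z → Fin 2) × (X → Fin 2) → Matrix (ι → Fin 2) (ι → Fin 2) ℂ := fun p =>
    F * decodeStep X dX p.2 * F * decodeStep Z dZ p.1
  have hR : ∑ p, (R p).conjTranspose * R p = 1 := by
    have hp : ∀ p, (R p).conjTranspose * R p = (decodeStep Z dZ p.1).conjTranspose *
        (F * ((decodeStep X dX p.2).conjTranspose * decodeStep X dX p.2) * F) *
          decodeStep Z dZ p.1 := by
      intro p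
      simp only [R, Matrix.conjTranspose_mul, F, fourier_conjTranspose]
      simp only [mul_assoc]
      rw [← mul_assoc (fourier ι) (fourier ι), fourier_sq, one_mul]
    simp only [hp]
    rw [Fintype.sum_prod_type]
    simp only [← Finset.sum_mul, ← Finset.mul_sum, sum_decodeStep, mul_one]
    simp only [F, fourier_sq, mul_one, sum_decodeStep]
  refine ⟨Fintype.card ((Z → Fin 2) × (X → Fin 2)), fun k => R ((Fintype.equivFin _).symm k),
    ?_, ?_⟩
  · rw [← hR]
    exact Equiv.sum_comp (Fintype.equivFin ((Z → Fin 2) × (X → Fin 2))).symm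
      (fun p => (R p).conjTranspose * R p)
  intro T hT E hE k
  dsimp only
  generalize (Fintype.equivFin _).symm k = p
  replace hE := errorsOn_le_span_pauli T hE
  induction hE using Submodule.span_induction with
  | zero => exact ⟨0, fun ψ _ => by simp⟩
  | add E E' _ _ h h' =>
    obtain ⟨r, hr⟩ := h
    obtain ⟨r', hr'⟩ := h'
    exact ⟨r + r', fun ψ hψ => by
      rw [Matrix.add_mulVec, Matrix.mulVec_add, hr ψ hψ, hr' ψ hψ, add_smul]⟩
  | smul a E _ h =>
    obtain ⟨r, hr⟩ := h
    exact ⟨a * r, fun ψ hψ => by rw [Matrix.smul_mulVec, Matrix.mulVec_smul, hr ψ hψ, smul_smul]⟩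
  | mem E h =>
    obtain ⟨A, B, hA, hB, rfl⟩ := h
    refine ⟨(if p.1 = syndrome Z (ind A) then 1 else 0) *
      (if p.2 = syndrome X (ind B) then 1 else 0), fun ψ hψ => ?_⟩
    have hψZ := (mem_stabilizerCode.1 hψ).2
    have hflip : (decodeStep Z dZ p.1).mulVec
        ((opOn A sigmaX).mulVec ((opOn B sigmaZ).mulVec ψ)) =
        (if p.1 = syndrome Z (ind A) then (1 : ℂ) else 0) • (opOn B sigmaZ).mulVec ψ := by
      convert decodeStep_mulVec (hdZ T hT A hA) (φ := (opOn B sigmaZ).mulVec ψ)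
        (fun x hx => hψZ x fun h0 => hx (by rw [opOn_sigmaZ_mulVec]; simp [h0])) p.1
    have hdual : ∀ x, F.mulVec ψ x ≠ 0 → ∀ S ∈ X, parity S x = 0 := by
      intro x hx S hS
      have h1 : (opOn S sigmaZ).mulVec (F.mulVec ψ) = F.mulVec ψ := by
        rw [Matrix.mulVec_mulVec, ← fourier_sigmaX, ← Matrix.mulVec_mulVec, hψ.1 S hS]
      rw [opOn_sigmaZ_mulVec] at h1
      exact sgn_eq_one.1 (mul_right_cancel₀ hx ((congrFun h1 x).trans (one_mul _).symm))
    have hphase : (decodeStep X dX p.2).mulVec ((opOn B sigmaX).mulVec (F.mulVec ψ)) =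
        (if p.2 = syndrome X (ind B) then (1 : ℂ) else 0) • F.mulVec ψ := by
      convert decodeStep_mulVec (hdX T hT B hB) hdual p.2
    have hFB : F.mulVec ((opOn B sigmaZ).mulVec ψ) = (opOn B sigmaX).mulVec (F.mulVec ψ) := by
      rw [Matrix.mulVec_mulVec, fourier_sigmaZ, ← Matrix.mulVec_mulVec]
    simp only [R, ← Matrix.mulVec_mulVec]
    rw [hflip, Matrix.mulVec_smul, Matrix.mulVec_smul, Matrix.mulVec_smul, hFB, hphase,
      Matrix.mulVec_smul, Matrix.mulVec_mulVec, fourier_sq, Matrix.one_mulVec, smul_smul]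

end CSS

/-! ### The lattice code as the kernel of a linear functional -/

section Lattice

/-- The last coordinate of the generator `(0, …, 0, 1, …, 1, *)` with entries `1` at the positions
`k, …, n - 1`; for `k = n - 1` this generator is `vOne`. The value is `0` for `k ≥ n`. -/
def lastCoeff (n : ℕ) (c : ℕ → ℤ) (k : ℕ) : ℤ :=
  if k + 1 < n then c k else if k + 1 = n then -3 else 0

/-- The coefficients of the linear functional that vanishes on the code (coordinates are counted
from `0`). -/
def dualCoeff (n : ℕ) (c : ℕ → ℤ) (i : ℕ) : ℤ :=
  if i = 0 then 2 else if i + 1 = n then -1 else lastCoeff n c (i + 1) - lastCoeff n c (i + 2)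

/-- The linear functional on `ℤ_q ^ n` whose kernel is the code. -/
def dual (n : ℕ) (c : ℕ → ℤ) : Site n →+ ZMod (2 * n + 1) where
  toFun x := ∑ i : Fin n, (dualCoeff n c i : ZMod (2 * n + 1)) * x i
  map_zero' := by simp
  map_add' x y := by simp [mul_add, Finset.sum_add_distrib]

variable {n : ℕ} {c : ℕ → ℤ}

lemma dual_apply (x : Site n) :
    dual n c x = ∑ i : Fin n, (dualCoeff n c i : ZMod (2 * n + 1)) * x i := rfl

lemma dual_single (i : Fin n) (t : ZMod (2 * n + 1)) :
    dual n c (Pi.single i t) = dualCoeff n c i * t := by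
  rw [dual_apply, Finset.sum_eq_single i]
  · simp
  · intro j _ hj; simp [hj]
  · simp

lemma dual_reduce (w : Fin n → ℤ) :
    dual n c (reduce n w) = ((∑ i : Fin n, dualCoeff n c i * w i : ℤ) : ZMod (2 * n + 1)) := by
  simp [dual_apply, reduce]

lemma modulus_eq_zero : (2 * n + 1 : ZMod (2 * n + 1)) = 0 := by
  have := ZMod.natCast_self (2 * n + 1)
  push_cast at this
  exact this

lemma dual_vFirst (hn : 5 ≤ n) : dual n c (reduce n (vFirst n)) = 0 := by
  obtain ⟨m, rfl⟩ : ∃ m, n = m + 2 := ⟨n - 2, by omega⟩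
  rw [dual_reduce]
  simp only [vFirst]
  rw [Fin.sum_univ_eq_sum_range (fun i => dualCoeff (m + 2) c i * if i + 2 = m + 2 then (1 : ℤ)
    else if i + 1 = m + 2 then 2 * ((m + 2 : ℕ) : ℤ) - 2 else 0), Finset.sum_range_succ,
    Finset.sum_range_succ, Finset.sum_eq_zero]
  · have h1 : dualCoeff (m + 2) c m = -3 := by
      unfold dualCoeff lastCoeff
      rw [if_neg (by omega), if_neg (by omega), if_neg (by omega), if_pos (by omega),
        if_neg (by omega), if_neg (by omega)]
      rfl
    have h2 : dualCoeff (m + 2) c (m + 1) = -1 := by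
      unfold dualCoeff
      rw [if_neg (by omega), if_pos (by omega)]
    rw [h1, h2]
    have := modulus_eq_zero (n := m + 2)
    push_cast at this ⊢
    simp only [if_true]
    rw [if_neg (by omega)]
    linear_combination -this
  · intro i hi
    have := Finset.mem_range.1 hi
    rw [if_neg (by omega), if_neg (by omega), mul_zero]

lemma dual_vOne (hn : 5 ≤ n) : dual n c (reduce n (vOne n)) = 0 := by
  have : reduce n (vOne n) = reduce n (vFirst n) := by
    ext i
    simp only [reduce, vOne, vFirst, AddMonoidHom.coe_mk, ZeroHom.coe_mk]
    have := modulus_eq_zero (n := n)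
    split_ifs
    · rfl
    · push_cast
      linear_combination -this
    · rfl
  rw [this, dual_vFirst hn]

lemma dual_vLast (hn : 5 ≤ n) : dual n c (reduce n (vLast n)) = 0 := by
  obtain ⟨m, rfl⟩ : ∃ m, n = m + 2 := ⟨n - 2, by omega⟩
  rw [dual_reduce]
  simp only [vLast]
  rw [Fin.sum_univ_eq_sum_range (fun i => dualCoeff (m + 2) c i * if i = 0 then (1 : ℤ)
    else if i + 1 = m + 2 then 2 else 0), Finset.sum_range_succ,
    Finset.sum_range_succ', Finset.sum_eq_zero]
  · simp [dualCoeff]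
  · intro i hi
    have := Finset.mem_range.1 hi
    rw [if_neg (by omega), if_neg (by omega), mul_zero]

lemma dual_vMid {k : ℕ} (hk : 2 ≤ k) (hkn : k + 2 ≤ n) :
    dual n c (reduce n (vMid n c k)) = 0 := by
  obtain ⟨m, rfl⟩ : ∃ m, n = m + 1 := ⟨n - 1, by omega⟩
  rw [dual_reduce]
  have tele : ∀ (L : ℕ → ℤ) (M : ℕ), ∑ i ∈ Finset.range M,
      (if k ≤ i + 1 then L (i + 1) - L (i + 2) else 0) =
        if k ≤ M then L k - L (M + 1) else 0 := by
    intro L M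
    induction M with
    | zero => rw [Finset.sum_range_zero, if_neg (by omega)]
    | succ M ih =>
      rw [Finset.sum_range_succ, ih]
      rcases lt_trichotomy k (M + 1) with h | h | h
      · rw [if_pos (by omega), if_pos (by omega), if_pos (by omega)]; ring
      · rw [if_neg (by omega), if_pos (by omega), if_pos (by omega), h]; ring
      · rw [if_neg (by omega), if_neg (by omega), if_neg (by omega)]; ring
  simp only [vMid]
  rw [Fin.sum_univ_eq_sum_range (fun i => dualCoeff (m + 1) c i * if i + 1 = m + 1 then c k
    else if k ≤ i + 1 then 1 else 0), Finset.sum_range_succ]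
  have : ∀ i ∈ Finset.range m, (dualCoeff (m + 1) c i * if i + 1 = m + 1 then c k
      else if k ≤ i + 1 then 1 else 0) = if k ≤ i + 1 then
        lastCoeff (m + 1) c (i + 1) - lastCoeff (m + 1) c (i + 2) else 0 := by
    intro i hi
    have := Finset.mem_range.1 hi
    rw [if_neg (by omega)]
    split_ifs with h
    · rw [mul_one, dualCoeff, if_neg (by omega), if_neg (by omega)]
    · rw [mul_zero]
  rw [Finset.sum_congr rfl this, tele, if_pos (by omega), if_pos rfl]
  have h1 : lastCoeff (m + 1) c k = c k := by rw [lastCoeff, if_pos (by omega)]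
  have h2 : lastCoeff (m + 1) c (m + 1) = 0 := by
    rw [lastCoeff, if_neg (by omega), if_neg (by omega)]
  have h3 : dualCoeff (m + 1) c m = -1 := by rw [dualCoeff, if_neg (by omega), if_pos rfl]
  rw [h1, h2, h3]
  simp

lemma dual_eq_zero_of_mem (hn : 5 ≤ n) {x : Site n} (hx : x ∈ latticeCode n c) :
    dual n c x = 0 := by
  have : latticeCode n c ≤ (dual n c).ker := by
    refine AddSubgroup.map_le_iff_le_comap.2 ((AddSubgroup.closure_le _).2 ?_)
    rintro w ((rfl | rfl | rfl) | ⟨k, hk, hkn, rfl⟩)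
    exacts [dual_vFirst hn, dual_vOne hn, dual_vLast hn, dual_vMid hk hkn]
  exact this hx

lemma gen_mem {k : ℕ} (hk : k + 1 < n) : reduce n (gen n c k) ∈ latticeCode n c := by
  refine AddSubgroup.mem_map_of_mem _ (AddSubgroup.subset_closure ?_)
  unfold gen
  split_ifs with h1 h2
  · simp
  · simp
  · exact Or.inr ⟨k + 1, by omega, by omega, rfl⟩

lemma codeword_eq_sum (m : ℕ) : codeword n c m = ∑ k ∈ Finset.range (n - 1),
    (m / (2 * n + 1) ^ k % (2 * n + 1)) • reduce n (gen n c k) := by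
  simp only [codeword, map_sum, map_nsmul]

lemma codeword_mem (m : ℕ) : codeword n c m ∈ latticeCode n c := by
  rw [codeword_eq_sum]
  exact AddSubgroup.sum_mem _ fun k hk => AddSubgroup.nsmul_mem _
    (gen_mem (by have := Finset.mem_range.1 hk; omega)) _

lemma gen_zero_coord (hn : 5 ≤ n) {k : ℕ} (i : Fin n) (hi : (i : ℕ) = 0) :
    gen n c k i = if k + 2 = n then 1 else 0 := by
  unfold gen
  split_ifs with h1 h2 h2
  · omega
  · rw [vFirst, if_neg (by omega), if_neg (by omega)]
  · rw [vLast, if_pos hi]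
  · rw [vMid, if_neg (by omega), if_neg (by omega)]

/-- The first coordinate of a codeword is the number of its cross-section. -/
lemma codeword_first (hn : 5 ≤ n) {m : ℕ} (hm : m < (2 * n + 1) ^ (n - 1)) (i : Fin n)
    (hi : (i : ℕ) = 0) :
    codeword n c m i = ((m / (2 * n + 1) ^ (n - 2) : ℕ) : ZMod (2 * n + 1)) := by
  rw [codeword_eq_sum, Finset.sum_apply]
  simp only [Pi.smul_apply, reduce, AddMonoidHom.coe_mk, ZeroHom.coe_mk, gen_zero_coord hn i hi]
  rw [Finset.sum_eq_single (n - 2)]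
  · rw [if_pos (by omega), Nat.mod_eq_of_lt]
    · simp
    · rw [Nat.div_lt_iff_lt_mul (by positivity), ← pow_succ', show n - 2 + 1 = n - 1 by omega]
      exact hm
  · intro k _ hk
    rw [if_neg (by omega)]
    simp
  · intro h
    exact absurd (Finset.mem_range.2 (by omega)) h

/-- Two vectors in the kernel of the functional that differ at most in the last coordinate
agree. -/
lemma eq_of_dual_eq_zero {x y : Site n} (hn : 5 ≤ n) (hx : dual n c x = 0) (hy : dual n c y = 0)
    (h : ∀ i : Fin n, (i : ℕ) + 1 < n → x i = y i) : x = y := by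
  have hs : x - y = Pi.single ⟨n - 1, by omega⟩ ((x - y) ⟨n - 1, by omega⟩) := by
    ext i
    by_cases hi : i = ⟨n - 1, by omega⟩
    · rw [hi, Pi.single_eq_same]
    · rw [Pi.single_eq_of_ne hi, Pi.sub_apply, h i, sub_self]
      have : (i : ℕ) ≠ n - 1 := fun h' => hi (Fin.ext h')
      omega
  have h0 : dual n c (x - y) = 0 := by rw [map_sub, hx, hy, sub_zero]
  rw [hs, dual_single, dualCoeff, if_neg (by simp; omega), if_pos (by simp; omega)] at h0
  rw [← sub_eq_zero, hs]
  have : (x - y) ⟨n - 1, by omega⟩ = 0 := by simpa [-Pi.sub_apply] using h0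
  rw [this, Pi.single_zero]

/-- Every vector in the kernel of the functional is a combination of the generators; the
coefficients are differences of consecutive coordinates. -/
lemma exists_coeff (hn : 5 ≤ n) {x : Site n} (hx : dual n c x = 0) : ∃ d : ℕ → ZMod (2 * n + 1),
    x = ∑ k ∈ Finset.range (n - 1), (d k).val • reduce n (gen n c k) := by
  obtain ⟨m, rfl⟩ : ∃ m, n = m + 3 := ⟨n - 3, by omega⟩
  let X : ℕ → ZMod (2 * (m + 3) + 1) := fun i => if h : i < m + 3 then x ⟨i, h⟩ else 0
  let z : ℕ → ZMod (2 * (m + 3) + 1) := fun k => if k = 0 then 0 else X k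
  have hX : ∀ i : Fin (m + 3), x i = X i := fun i => by simp [X, i.2]
  let d : ℕ → ZMod (2 * (m + 3) + 1) := fun k => if k = 0 then X (m + 1) - X m else
    if k = m + 1 then X 0 else z k - z (k - 1)
  refine ⟨d, eq_of_dual_eq_zero hn hx ?_ ?_⟩
  · exact dual_eq_zero_of_mem hn (AddSubgroup.sum_mem _ fun k hk => AddSubgroup.nsmul_mem _
      (gen_mem (by have := Finset.mem_range.1 hk; omega)) _)
  intro i hi
  have tele : ∀ M : ℕ, ∑ k ∈ Finset.range M, (if k + 1 ≤ (i : ℕ) then z (k + 1) - z k else 0) =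
      z (min i M) := by
    intro M
    induction M with
    | zero => simp [z]
    | succ M ih =>
      rw [Finset.sum_range_succ, ih]
      by_cases h : M + 1 ≤ i
      · rw [if_pos h, min_eq_right h, min_eq_right (by omega)]; ring
      · rw [if_neg h, min_eq_left (by omega), min_eq_left (by omega), add_zero]
  rw [Finset.sum_apply]
  simp only [Pi.smul_apply, reduce, AddMonoidHom.coe_mk, ZeroHom.coe_mk, nsmul_eq_mul,
    ZMod.natCast_zmod_val]
  rw [show m + 3 - 1 = m + 1 + 1 by omega, Finset.sum_range_succ, Finset.sum_range_succ']
  have hmid : ∀ k ∈ Finset.range m, d (k + 1) * (gen (m + 3) c (k + 1) i : ZMod (2 * (m + 3) + 1)) =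
      if k + 1 ≤ (i : ℕ) then z (k + 1) - z k else 0 := by
    intro k hk
    have := Finset.mem_range.1 hk
    have hd : d (k + 1) = z (k + 1) - z k := by
      simp only [d]
      rw [if_neg (by omega), if_neg (by omega), Nat.add_sub_cancel]
    rw [hd, gen, if_neg (by omega), if_neg (by omega), vMid, if_neg (by omega)]
    by_cases h : k + 1 ≤ (i : ℕ)
    · rw [if_pos h, if_pos (by omega)]; simp
    · rw [if_neg h, if_neg (by omega)]; simp
  have h0 : d 0 * (gen (m + 3) c 0 i : ZMod (2 * (m + 3) + 1)) =
      if (i : ℕ) = m + 1 then X (m + 1) - X m else 0 := by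
    rw [gen, if_pos rfl, vFirst]
    by_cases h : (i : ℕ) = m + 1
    · rw [if_pos h, if_pos (by omega)]; simp [d]
    · rw [if_neg h, if_neg (by omega), if_neg (by omega)]; simp
  have hl : d (m + 1) * (gen (m + 3) c (m + 1) i : ZMod (2 * (m + 3) + 1)) =
      if (i : ℕ) = 0 then X 0 else 0 := by
    rw [gen, if_neg (by omega), if_pos (by omega), vLast]
    by_cases h : (i : ℕ) = 0
    · rw [if_pos h, if_pos h]; simp [d]
    · rw [if_neg h, if_neg h, if_neg (by omega)]; simp
  rw [Finset.sum_congr rfl hmid, tele, h0, hl, hX]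
  by_cases h1 : (i : ℕ) = 0
  · rw [if_neg (by omega), if_pos h1, h1]; simp [z]
  · rw [if_neg h1]
    by_cases h2 : (i : ℕ) = m + 1
    · rw [if_pos h2, h2, min_eq_right (by omega)]
      simp only [z]
      rw [if_neg (by omega)]; ring
    · rw [if_neg h2, min_eq_left (by omega)]
      simp only [z]
      rw [if_neg h1]; ring

lemma exists_codeword (hn : 5 ≤ n) {x : Site n} (hx : dual n c x = 0) :
    ∃ m < (2 * n + 1) ^ (n - 1), codeword n c m = x := by
  obtain ⟨d, hd⟩ := exists_coeff hn hx
  let f : Fin (n - 1) → Fin (2 * n + 1) := fun k => ⟨(d k).val, ZMod.val_lt _⟩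
  refine ⟨finFunctionFinEquiv f, (finFunctionFinEquiv f).2, ?_⟩
  rw [codeword_eq_sum]
  refine Eq.trans (Finset.sum_congr rfl fun k hk => ?_) hd.symm
  congr 1
  have h := congrArg Fin.val
    (congrFun (finFunctionFinEquiv.symm_apply_apply f) ⟨k, Finset.mem_range.1 hk⟩)
  exact h

theorem mem_latticeCode_iff (hn : 5 ≤ n) {x : Site n} :
    x ∈ latticeCode n c ↔ dual n c x = 0 := by
  refine ⟨dual_eq_zero_of_mem hn, fun h => ?_⟩
  obtain ⟨m, -, rfl⟩ := exists_codeword hn h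
  exact codeword_mem m

lemma dualCoeff_last (hn : 5 ≤ n) : dualCoeff n c (n - 1) = -1 := by
  rw [dualCoeff, if_neg (by omega), if_pos (by omega)]

lemma dual_surjective (hn : 5 ≤ n) : Function.Surjective (dual n c) := fun t =>
  ⟨Pi.single ⟨n - 1, by omega⟩ (-t), by rw [dual_single, dualCoeff_last hn]; simp⟩

theorem card_latticeCode (hn : 5 ≤ n) :
    Nat.card (latticeCode n c) = (2 * n + 1) ^ (n - 1) := by
  have hker : latticeCode n c = (dual n c).ker := by
    ext x; exact mem_latticeCode_iff hn
  have h := AddSubgroup.card_mul_index (dual n c).ker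
  rw [AddSubgroup.index_ker, AddMonoidHom.range_eq_top.2 (dual_surjective hn)] at h
  rw [AddSubgroup.card_top, Nat.card_zmod, ← hker, Nat.card_pi] at h
  simp only [Nat.card_zmod, Finset.prod_const, Finset.card_univ, Fintype.card_fin] at h
  refine Nat.eq_of_mul_eq_mul_right (show 0 < 2 * n + 1 by omega) ?_
  rw [← pow_succ, show n - 1 + 1 = n by omega]
  exact h

theorem codeword_bijOn (hn : 5 ≤ n) :
    Set.BijOn (codeword n c) (Set.Iio ((2 * n + 1) ^ (n - 1))) (latticeCode n c) := by
  have hsurj : Set.SurjOn (codeword n c) (Set.Iio ((2 * n + 1) ^ (n - 1))) (latticeCode n c) := by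
    intro x hx
    obtain ⟨m, hm, h⟩ := exists_codeword hn (dual_eq_zero_of_mem hn hx)
    exact ⟨m, hm, h⟩
  refine ⟨fun m _ => codeword_mem m, ?_, hsurj⟩
  refine Set.injOn_of_ncard_image_eq ?_ (Set.finite_Iio _)
  rw [Set.Subset.antisymm (Set.image_subset_iff.2 fun m _ => codeword_mem m) hsurj,
    Set.ncard_eq_toFinset_card' (Set.Iio _), Set.toFinset_Iio, Nat.card_Iio]
  exact card_latticeCode hn

end Lattice

/-! ### Mannheim weight and close packing -/

section Packing

variable {n : ℕ} {c : ℕ → ℤ}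

lemma mannheimWeight_zero : mannheimWeight (0 : Site n) = 0 := by simp [mannheimWeight]

lemma mannheimWeight_neg (x : Site n) : mannheimWeight (-x) = mannheimWeight x := by
  simp [mannheimWeight]

lemma mannheimWeight_sub_comm (x y : Site n) :
    mannheimWeight (x - y) = mannheimWeight (y - x) := by
  rw [← mannheimWeight_neg, neg_sub]

lemma mannheimWeight_eq_zero {x : Site n} : mannheimWeight x = 0 ↔ x = 0 := by
  simp [mannheimWeight, funext_iff]

lemma mannheimWeight_single (i : Fin n) (t : ZMod (2 * n + 1)) :
    mannheimWeight (Pi.single i t) = t.valMinAbs.natAbs := by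
  rw [mannheimWeight, Finset.sum_eq_single i]
  · simp
  · intro j _ hj; simp [hj]
  · simp

lemma valMinAbs_one (hn : 1 ≤ n) : (1 : ZMod (2 * n + 1)).valMinAbs = 1 := by
  rw [ZMod.valMinAbs_spec]
  refine ⟨by simp, ?_, ?_⟩ <;> push_cast <;> omega

lemma mannheimWeight_single_one (hn : 5 ≤ n) (i : Fin n) :
    mannheimWeight (Pi.single i (1 : ZMod (2 * n + 1))) = 1 := by
  rw [mannheimWeight_single, valMinAbs_one (by omega)]; rfl

lemma mannheimWeight_single_neg_one (hn : 5 ≤ n) (i : Fin n) :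
    mannheimWeight (Pi.single i (-1 : ZMod (2 * n + 1))) = 1 := by
  rw [mannheimWeight_single, ZMod.natAbs_valMinAbs_neg, valMinAbs_one (by omega)]; rfl

/-- A nonzero vector has a neighbour of smaller weight. -/
lemma exists_mannheimWeight_sub_single (hn : 5 ≤ n) {x : Site n} (hx : x ≠ 0) :
    ∃ (i : Fin n) (t : ZMod (2 * n + 1)), (t = 1 ∨ t = -1) ∧
      mannheimWeight (x - Pi.single i t) + 1 = mannheimWeight x := by
  obtain ⟨i, hi⟩ := Function.ne_iff.1 hx
  have hi : (x i).valMinAbs ≠ 0 := by simpa using hi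
  have hmem := ZMod.valMinAbs_mem_Ioc (x i)
  have hstep : ∀ (t : ZMod (2 * n + 1)),
      ((x i - t).valMinAbs.natAbs + 1 = (x i).valMinAbs.natAbs) →
      mannheimWeight (x - Pi.single i t) + 1 = mannheimWeight x := by
    intro t ht
    unfold mannheimWeight
    rw [← Finset.add_sum_erase _ _ (Finset.mem_univ i),
      ← Finset.add_sum_erase _ (fun j => (x j).valMinAbs.natAbs) (Finset.mem_univ i), ← ht]
    have : ∑ j ∈ Finset.univ.erase i, ((x - Pi.single i t : Site n) j).valMinAbs.natAbs =
        ∑ j ∈ Finset.univ.erase i, (x j).valMinAbs.natAbs := by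
      refine Finset.sum_congr rfl fun j hj => ?_
      simp [Finset.ne_of_mem_erase hj]
    rw [this]
    simp only [Pi.sub_apply, Pi.single_eq_same]
    ring
  rcases lt_or_gt_of_ne hi with h | h
  · refine ⟨i, -1, Or.inr rfl, hstep _ ?_⟩
    have : (x i - -1).valMinAbs = (x i).valMinAbs + 1 := by
      rw [ZMod.valMinAbs_spec]
      refine ⟨by simp, ?_, ?_⟩
      · have := hmem.1; push_cast at this ⊢; omega
      · push_cast; omega
    omega
  · refine ⟨i, 1, Or.inl rfl, hstep _ ?_⟩
    have : (x i - 1).valMinAbs = (x i).valMinAbs - 1 := by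
      rw [ZMod.valMinAbs_spec]
      refine ⟨by simp, ?_, ?_⟩
      · push_cast; omega
      · have := hmem.2; push_cast at this ⊢; omega
    omega

/-- The hypercubes of the Lee sphere of radius 1 around `0`: the origin and its neighbours. -/
lemma mannheimWeight_le_one_iff (hn : 5 ≤ n) {x : Site n} : mannheimWeight x ≤ 1 ↔
    x = 0 ∨ ∃ (i : Fin n) (t : ZMod (2 * n + 1)), (t = 1 ∨ t = -1) ∧ x = Pi.single i t := by
  constructor
  · intro h
    by_cases hx : x = 0
    · exact Or.inl hx
    · obtain ⟨i, t, ht, hw⟩ := exists_mannheimWeight_sub_single hn hx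
      exact Or.inr ⟨i, t, ht, sub_eq_zero.1 (mannheimWeight_eq_zero.1 (by omega))⟩
  · rintro (rfl | ⟨i, t, rfl | rfl, rfl⟩)
    · rw [mannheimWeight_zero]; omega
    · rw [mannheimWeight_single_one hn]
    · rw [mannheimWeight_single_neg_one hn]

lemma isClosePacking_iff (hn : 5 ≤ n) : IsClosePacking n c ↔
    Function.Bijective fun y : LeeSphere n => dual n c y.1 := by
  rw [Function.bijective_iff_existsUnique]
  constructor
  · intro h t
    obtain ⟨x, rfl⟩ := dual_surjective (c := c) hn t
    obtain ⟨w, ⟨hw, hxw⟩, huniq⟩ := h x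
    refine ⟨⟨x - w, hxw⟩, ?_, ?_⟩
    · simp [(mem_latticeCode_iff hn).1 hw]
    · rintro ⟨y, hy⟩ hyx
      have := huniq (x - y) ⟨(mem_latticeCode_iff hn).2 (by
        rw [map_sub, sub_eq_zero]; exact hyx.symm), by rwa [sub_sub_cancel]⟩
      exact Subtype.ext (by simp [← this])
  · intro h x
    obtain ⟨y, hy, huniq⟩ := h (dual n c x)
    dsimp only at hy huniq
    refine ⟨x - y.1, ⟨(mem_latticeCode_iff hn).2 (by rw [map_sub, hy, sub_self]),
      by rw [sub_sub_cancel]; exact y.2⟩, ?_⟩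
    rintro w ⟨hw, hxw⟩
    have := huniq ⟨x - w, hxw⟩ (by simp [(mem_latticeCode_iff hn).1 hw])
    rw [← this]
    simp

/-- The coefficients of the functional for the standard choice of the lattice. -/
lemma dualCoeff_standard {i : ℕ} (hi : i < n) :
    (dualCoeff n (standardLast n) i : ZMod (2 * n + 1)) = 2 * ((i : ZMod (2 * n + 1)) + 1) := by
  have hq := modulus_eq_zero (n := n)
  have hs : ∀ k, (standardLast n k : ZMod (2 * n + 1)) =
      1 - ((n : ZMod (2 * n + 1)) - k + 1) ^ 2 := by
    intro k
    have := ZMod.intCast_mod (1 - ((n : ℤ) - k + 1) ^ 2) (2 * n + 1)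
    push_cast at this
    rw [standardLast, this]
  unfold dualCoeff lastCoeff
  by_cases h0 : i = 0
  · rw [if_pos h0, h0]; simp
  rw [if_neg h0]
  by_cases h1 : i + 1 = n
  · have : (i : ZMod (2 * n + 1)) + 1 = n := by exact_mod_cast congrArg Nat.cast h1
    rw [if_pos h1, this]; push_cast; linear_combination -hq
  rw [if_neg h1]
  by_cases h2 : i + 2 = n
  · have : (i : ZMod (2 * n + 1)) + 2 = n := by exact_mod_cast congrArg Nat.cast h2
    rw [if_neg (by omega), if_pos (by omega), if_neg (by omega), if_neg (by omega)]
    push_cast; linear_combination -hq - 2 * this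
  by_cases h3 : i + 3 = n
  · have : (i : ZMod (2 * n + 1)) + 3 = n := by exact_mod_cast congrArg Nat.cast h3
    rw [if_pos (by omega), if_neg (by omega), if_pos (by omega)]
    push_cast
    rw [hs, ← this]
    push_cast
    rw [← this] at hq
    linear_combination -hq
  · rw [if_pos (by omega), if_pos (by omega)]
    push_cast
    rw [hs, hs]
    push_cast
    linear_combination -hq

theorem isClosePacking_standard (hn : 5 ≤ n) : IsClosePacking n (standardLast n) := by
  rw [isClosePacking_iff hn]
  have hcomp : Function.Surjective fun o : Option (Fin n × Bool) =>
      o.elim 0 fun p => dual n (standardLast n) (Pi.single p.1 (if p.2 then 1 else -1)) := by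
    intro t
    have hq := modulus_eq_zero (n := n)
    -- `n + 1` is the inverse of `2`
    set s : ℤ := (((n : ZMod (2 * n + 1)) + 1) * t).valMinAbs with hs
    have hst : 2 * (s : ZMod (2 * n + 1)) = t := by
      rw [hs, ZMod.coe_valMinAbs]; linear_combination t * hq
    have hmem := ZMod.valMinAbs_mem_Ioc (((n : ZMod (2 * n + 1)) + 1) * t)
    rw [← hs] at hmem
    have hlo := hmem.1
    have hhi := hmem.2
    push_cast at hlo hhi
    rcases lt_trichotomy s 0 with h | h | h
    · refine ⟨some (⟨(-s).toNat - 1, by omega⟩, false), ?_⟩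
      simp only [Option.elim, dual_single]
      rw [dualCoeff_standard (by omega)]
      have : ((((-s).toNat - 1 : ℕ) : ℤ) : ZMod (2 * n + 1)) = ((-s - 1 : ℤ) : ZMod (2 * n + 1)) :=
        congrArg _ (by omega)
      push_cast at this
      simp only [this, ← hst]
      simp
    · exact ⟨none, by simp [← hst, h]⟩
    · refine ⟨some (⟨s.toNat - 1, by omega⟩, true), ?_⟩
      simp only [Option.elim, dual_single]
      rw [dualCoeff_standard (by omega)]
      have : (((s.toNat - 1 : ℕ) : ℤ) : ZMod (2 * n + 1)) = ((s - 1 : ℤ) : ZMod (2 * n + 1)) :=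
        congrArg _ (by omega)
      push_cast at this
      simp only [this, ← hst]
      simp
  let e : Option (Fin n × Bool) → LeeSphere n := fun o =>
    ⟨o.elim 0 fun p => Pi.single p.1 (if p.2 then 1 else -1), by
      rw [mannheimWeight_le_one_iff hn]
      rcases o with _ | ⟨i, b⟩
      · exact Or.inl rfl
      · refine Or.inr ⟨i, _, ?_, rfl⟩
        cases b <;> simp⟩
  have he : Function.Surjective e := by
    rintro ⟨x, hx⟩
    rcases (mannheimWeight_le_one_iff hn).1 hx with rfl | ⟨i, t, rfl | rfl, rfl⟩
    · exact ⟨none, rfl⟩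
    · exact ⟨some (i, true), by simp [e]⟩
    · exact ⟨some (i, false), by simp [e]⟩
  have hfac : (fun o : Option (Fin n × Bool) =>
      o.elim 0 fun p => dual n (standardLast n) (Pi.single p.1 (if p.2 then 1 else -1))) =
      (fun y : LeeSphere n => dual n (standardLast n) y.1) ∘ e := by
    ext o
    rcases o with _ | p
    · simp [e]
    · rfl
  -- the sphere has at most `q` elements
  have hbij : Function.Bijective ((fun y : LeeSphere n => dual n (standardLast n) y.1) ∘ e) := by
    rw [← hfac, Fintype.bijective_iff_surjective_and_card]
    refine ⟨hcomp, ?_⟩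
    simp [ZMod.card]
    ring
  exact ⟨fun y y' h => by
    obtain ⟨o, rfl⟩ := he y
    obtain ⟨o', rfl⟩ := he y'
    exact congrArg e (hbij.1 h), hbij.2.of_comp⟩

lemma card_leeSphere (hn : 5 ≤ n) (hc : IsClosePacking n c) :
    Nat.card (LeeSphere n) = 2 * n + 1 := by
  rw [Nat.card_eq_of_bijective _ ((isClosePacking_iff hn).1 hc), Nat.card_zmod]

/-- The nearest codeword is unique. -/
lemma IsClosePacking.eq_of_near (hc : IsClosePacking n c) {x w w' : Site n}
    (hw : w ∈ latticeCode n c) (hw' : w' ∈ latticeCode n c) (h : mannheimWeight (x - w) ≤ 1)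
    (h' : mannheimWeight (x - w') ≤ 1) : w = w' :=
  (hc x).unique ⟨hw, h⟩ ⟨hw', h'⟩

theorem isLeast_mannheimWeight (hn : 5 ≤ n) (hc : IsClosePacking n c) :
    IsLeast {d | ∃ w ∈ latticeCode n c, w ≠ 0 ∧ d = mannheimWeight w} 3 := by
  constructor
  · have hw : mannheimWeight (reduce n (vLast n)) = 3 := by
      have : reduce n (vLast n) = Pi.single ⟨0, by omega⟩ 1 + Pi.single ⟨n - 1, by omega⟩ 2 := by
        ext i
        simp only [reduce, vLast, AddMonoidHom.coe_mk, ZeroHom.coe_mk, Pi.add_apply,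
          Pi.single_apply, Fin.ext_iff]
        split_ifs <;> first | omega | simp
      rw [this, mannheimWeight, ← Finset.add_sum_erase _ _ (Finset.mem_univ ⟨0, by omega⟩),
        ← Finset.add_sum_erase _ _ (Finset.mem_erase.2 ⟨_, Finset.mem_univ ⟨n - 1, by omega⟩⟩),
        Finset.sum_eq_zero]
      · have h1 : (⟨0, by omega⟩ : Fin n) ≠ ⟨n - 1, by omega⟩ := by
          rw [Ne, Fin.mk.injEq]; omega
        have h2 : (2 : ZMod (2 * n + 1)).valMinAbs = 2 := by
          rw [ZMod.valMinAbs_spec]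
          refine ⟨by simp, ?_, ?_⟩ <;> push_cast <;> omega
        simp [h1, h1.symm, h2, valMinAbs_one (show 1 ≤ n by omega)]
      · intro i hi
        simp only [Finset.mem_erase] at hi
        simp [Pi.single_eq_of_ne hi.1, Pi.single_eq_of_ne hi.2.1]
      · rw [Ne, Fin.mk.injEq]; omega
    refine ⟨_, (mem_latticeCode_iff hn).2 (dual_vLast hn), fun h => ?_, hw.symm⟩
    rw [h, mannheimWeight_zero] at hw
    omega
  · rintro _ ⟨w, hw, hw0, rfl⟩
    by_contra hlt
    obtain ⟨i, t, ht, hs⟩ := exists_mannheimWeight_sub_single hn hw0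
    refine hw0 (hc.eq_of_near (x := w - Pi.single i t) hw (AddSubgroup.zero_mem _) ?_ ?_)
    · rw [mannheimWeight_sub_comm, sub_sub_cancel]
      exact (mannheimWeight_le_one_iff hn).2 (Or.inr ⟨i, t, ht, rfl⟩)
    · rw [sub_zero]; omega

end Packing

/-! ### The group of vertices of the torus -/

section Torus

variable {n : ℕ} {c : ℕ → ℤ}

/-- The vertices of the torus form a cyclic group of order `q`. -/
noncomputable def torusEquiv (hn : 5 ≤ n) : TorusVertex n c ≃+ ZMod (2 * n + 1) :=
  (QuotientAddGroup.quotientAddEquivOfEq (show latticeCode n c = (dual n c).ker by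
    ext x; exact mem_latticeCode_iff hn)).trans
    (QuotientAddGroup.quotientKerEquivOfSurjective (dual n c) (dual_surjective hn))

lemma torusEquiv_toTorus (hn : 5 ≤ n) (x : Site n) :
    torusEquiv hn (toTorus n c x) = dual n c x := rfl

/-- The displacement of a vertex of the torus in the direction `i`. -/
noncomputable def unitStep (n : ℕ) (c : ℕ → ℤ) (i : Fin n) : TorusVertex n c :=
  toTorus n c (Pi.single i 1)

lemma card_torusVertex (hn : 5 ≤ n) : Fintype.card (TorusVertex n c) = 2 * n + 1 := by
  rw [Fintype.card_congr (torusEquiv hn).toEquiv, ZMod.card]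

lemma card_dirs (n k : ℕ) : Fintype.card (Dirs n k) = n.choose k := by
  rw [Fintype.card_finset_len, Fintype.card_fin]

lemma unitStep_ne_zero (hn : 5 ≤ n) (hc : IsClosePacking n c) (i : Fin n) :
    unitStep n c i ≠ 0 := by
  intro h
  have h0 : dual n c (Pi.single i 1) = dual n c 0 := by
    rw [← torusEquiv_toTorus hn, ← unitStep, h, map_zero, map_zero]
  have h1 := ((isClosePacking_iff hn).1 hc).1
    (a₁ := ⟨Pi.single i 1, (mannheimWeight_single_one hn i).le⟩)
    (a₂ := ⟨0, by rw [mannheimWeight_zero]; omega⟩) h0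
  have h2 := congrFun (congrArg Subtype.val h1) i
  dsimp only at h2
  rw [Pi.single_eq_same] at h2
  have := congrArg ZMod.valMinAbs h2
  rw [valMinAbs_one (by omega)] at this
  simp at this

lemma eq_zero_of_add_self (hn : 5 ≤ n) {g : TorusVertex n c} (h : g + g = 0) : g = 0 := by
  have h1 : torusEquiv hn g + torusEquiv hn g = 0 := by rw [← map_add, h, map_zero]
  have hq := modulus_eq_zero (n := n)
  refine (torusEquiv hn).injective ?_
  rw [map_zero]
  linear_combination (-(n : ZMod (2 * n + 1))) * h1 + torusEquiv hn g * hq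

/-- The last direction runs once through all vertices. -/
lemma sum_sub_nsmul (hn : 5 ≤ n) (X : TorusVertex n c → Fin 2) (v : TorusVertex n c) :
    ∑ j ∈ Finset.range (2 * n + 1), X (v - j • unitStep n c ⟨n - 1, by omega⟩) = ∑ w, X w := by
  have hL : torusEquiv hn (unitStep n c ⟨n - 1, by omega⟩) = -1 := by
    rw [unitStep, torusEquiv_toTorus, dual_single, dualCoeff_last hn]; simp
  have harg : ∀ j : ℕ, v - j • unitStep n c ⟨n - 1, by omega⟩ =
      (torusEquiv hn).symm (torusEquiv hn v + j) := by
    intro j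
    rw [AddEquiv.eq_symm_apply, map_sub, map_nsmul, hL]
    simp
  calc ∑ j ∈ Finset.range (2 * n + 1), X (v - j • unitStep n c ⟨n - 1, by omega⟩)
      = ∑ z : ZMod (2 * n + 1), X ((torusEquiv hn).symm (torusEquiv hn v + z)) := by
        simp only [harg]
        refine Finset.sum_nbij' (fun j => (j : ZMod (2 * n + 1))) ZMod.val ?_ ?_ ?_ ?_ ?_
        · simp
        · intro z _; exact Finset.mem_range.2 (ZMod.val_lt z)
        · intro j hj; exact ZMod.val_cast_of_lt (Finset.mem_range.1 hj)
        · intro z _; exact ZMod.natCast_zmod_val z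
        · simp
    _ = ∑ z : ZMod (2 * n + 1), X ((torusEquiv hn).symm z) :=
        Equiv.sum_comp (Equiv.addLeft (torusEquiv hn v)) fun z => X ((torusEquiv hn).symm z)
    _ = _ := Equiv.sum_comp (torusEquiv hn).symm.toEquiv X

/-- With `S` the shift by one step in the last direction,
`(1 + S) (S + S³ + ⋯ + S^(q-2)) = S + S² + ⋯ + S^(q-1)`, which differs from the sum over all
vertices by the identity. -/
lemma sum_odd_shift (hn : 5 ≤ n) (X : TorusVertex n c → Fin 2) (v : TorusVertex n c) :
    ∑ j ∈ Finset.range n, (X (v - (2 * j + 1) • unitStep n c ⟨n - 1, by omega⟩) +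
      X (v - unitStep n c ⟨n - 1, by omega⟩ - (2 * j + 1) • unitStep n c ⟨n - 1, by omega⟩)) =
    X v + ∑ w, X w := by
  set t := unitStep n c ⟨n - 1, by omega⟩
  have hpair : ∀ (F : ℕ → Fin 2) (m : ℕ), ∑ j ∈ Finset.range (2 * m + 1), F j =
      F 0 + ∑ j ∈ Finset.range m, (F (2 * j + 1) + F (2 * j + 2)) := by
    intro F m
    induction m with
    | zero => simp
    | succ m ih =>
      rw [show 2 * (m + 1) + 1 = 2 * m + 1 + 1 + 1 by ring, Finset.sum_range_succ,
        Finset.sum_range_succ, ih, Finset.sum_range_succ]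
      simp only [add_assoc]
  rw [← sum_sub_nsmul hn X v, hpair, ← add_assoc, zero_smul, sub_zero, add_self_fin, zero_add]
  refine Finset.sum_congr rfl fun j _ => ?_
  rw [sub_sub v t, ← succ_nsmul']

end Torus

/-! ### Homology of the cubulated torus -/

section Homology

variable {n : ℕ} {c : ℕ → ℤ}

/-- A chain `y` of `k`-dimensional cells as a function of a vertex and an arbitrary set of
directions (with the value `0` on sets that do not consist of `k` directions). -/
def extChain {k : ℕ} (y : TorusCell n c k → Fin 2) (v : TorusVertex n c) (D : Finset (Fin n)) :
    Fin 2 :=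
  if h : D.card = k then y (v, ⟨D, h⟩) else 0

lemma extChain_of_card {k : ℕ} (y : TorusCell n c k → Fin 2) (v : TorusVertex n c)
    {D : Finset (Fin n)} (h : D.card = k) : extChain y v D = y (v, ⟨D, h⟩) := dif_pos h

/-- The sum of a chain over the cells that have a given facet `e`: for every direction `i` that does
not occur in `e` there are two of them. -/
lemma parity_cofacets (ht : ∀ i, unitStep n c i ≠ 0) {k : ℕ} (y : TorusCell n c (k + 1) → Fin 2)
    (e : TorusCell n c k) : parity {f | IsFacet e f} y = ∑ i, if i ∈ e.2.1 then 0 else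
      extChain y e.1 (insert i e.2.1) + extChain y (e.1 - unitStep n c i) (insert i e.2.1) := by
  classical
  have hsum : ∀ (v : TorusVertex n c) (i : Fin n), i ∉ e.2.1 →
      ∑ f : TorusCell n c (k + 1), (if f.2.1 = insert i e.2.1 ∧ f.1 = v then y f else 0) =
        extChain y v (insert i e.2.1) := by
    intro v i hi
    have hcard : (insert i e.2.1).card = k + 1 := by
      rw [Finset.card_insert_of_notMem hi, e.2.2]
    rw [extChain_of_card y v hcard, Finset.sum_eq_single (v, ⟨insert i e.2.1, hcard⟩)]
    · simp
    · rintro ⟨w, D, hD⟩ _ hne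
      refine if_neg ?_
      rintro ⟨h1, h2⟩
      dsimp only at h1 h2
      subst h1 h2
      exact hne rfl
    · simp
  have hpt : ∀ f : TorusCell n c (k + 1), Set.indicator {f | IsFacet e f} y f =
      ∑ i, if i ∈ e.2.1 then 0 else (if f.2.1 = insert i e.2.1 ∧ f.1 = e.1 then y f else 0) +
        (if f.2.1 = insert i e.2.1 ∧ f.1 = e.1 - unitStep n c i then y f else 0) := by
    intro f
    have hfacet : ∀ i, i ∉ e.2.1 → f.2.1 = insert i e.2.1 →
        (f.1 = e.1 ∨ f.1 = e.1 - unitStep n c i) → IsFacet e f := by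
      intro i hi hD hv
      refine ⟨i, by rw [hD]; exact Finset.mem_insert_self _ _, by
        rw [hD, Finset.erase_insert hi], ?_⟩
      rcases hv with hv | hv
      · exact Or.inl hv.symm
      · exact Or.inr (by rw [hv, ← unitStep, sub_add_cancel])
    by_cases hF : IsFacet e f
    · rw [Set.indicator_of_mem (show f ∈ {f | IsFacet e f} from hF)]
      obtain ⟨i, hi, hD, hv⟩ := hF
      have hie : i ∉ e.2.1 := by rw [hD]; exact Finset.notMem_erase _ _
      have hins : f.2.1 = insert i e.2.1 := by rw [hD, Finset.insert_erase hi]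
      rw [Finset.sum_eq_single i]
      · rw [if_neg hie]
        rcases hv with hv | hv
        · rw [if_pos ⟨hins, hv.symm⟩, if_neg, add_zero]
          rintro ⟨-, h⟩
          rw [← hv] at h
          exact ht i (sub_eq_self.1 h.symm)
        · rw [← unitStep] at hv
          rw [if_neg, if_pos ⟨hins, by rw [hv, add_sub_cancel_right]⟩, zero_add]
          rintro ⟨-, h⟩
          rw [hv] at h
          exact ht i (by simpa using h)
      · intro j _ hj
        by_cases hje : j ∈ e.2.1
        · rw [if_pos hje]
        · have : f.2.1 ≠ insert j e.2.1 := by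
            rw [hins]
            intro h
            have := h ▸ Finset.mem_insert_self i e.2.1
            rcases Finset.mem_insert.1 this with h | h
            · exact hj h.symm
            · exact hie h
          rw [if_neg hje, if_neg (fun h => this h.1), if_neg (fun h => this h.1), add_zero]
      · simp
    · rw [Set.indicator_of_notMem (show f ∉ {f | IsFacet e f} from hF)]
      refine (Finset.sum_eq_zero fun i _ => ?_).symm
      by_cases hi : i ∈ e.2.1
      · rw [if_pos hi]
      · rw [if_neg hi, if_neg (fun h => hF (hfacet i hi h.1 (Or.inl h.2))),
          if_neg (fun h => hF (hfacet i hi h.1 (Or.inr h.2))), add_zero]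
  rw [parity_apply, Finset.sum_congr rfl fun f _ => hpt f, Finset.sum_comm]
  refine Finset.sum_congr rfl fun i _ => ?_
  by_cases hi : i ∈ e.2.1
  · simp [hi]
  · simp only [if_neg hi]
    rw [Finset.sum_add_distrib, hsum _ i hi, hsum _ i hi]

/-- The boundary of a chain of cubes. -/
noncomputable def boundary (y : TorusCell n c 3 → Fin 2) (f : TorusCell n c 2) : Fin 2 :=
  parity {g | IsFacet f g} y

lemma ind_cubeCheck (g : TorusCell n c 3) : ind (cubeCheck g) = boundary (Pi.single g 1) := by
  classical
  ext1 f
  rw [boundary, parity_apply, Finset.sum_eq_single g]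
  · by_cases h : IsFacet f g
    · rw [Set.indicator_of_mem (show g ∈ {g | IsFacet f g} from h), Pi.single_eq_same]
      exact Set.indicator_of_mem (show f ∈ cubeCheck g from h) _
    · rw [Set.indicator_of_notMem (show g ∉ {g | IsFacet f g} from h)]
      exact Set.indicator_of_notMem (show f ∉ cubeCheck g from h) _
  · intro g' _ hg'
    simp [Set.indicator_apply, hg']
  · simp

lemma boundary_eq_sum (y : TorusCell n c 3 → Fin 2) :
    boundary y = ∑ g, if y g = 0 then 0 else ind (cubeCheck g) := by
  classical
  ext1 f
  rw [boundary, parity_apply, Finset.sum_apply]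
  refine Finset.sum_congr rfl fun g _ => ?_
  by_cases hy : y g = 0
  · simp [hy, Set.indicator_apply]
  · have hy1 : y g = 1 := by omega
    rw [if_neg hy]
    simp only [Set.indicator_apply, hy1, ind]
    rfl

lemma sum_eq_zero_of_symm {κ : Type*} [Fintype κ] (A : κ → κ → Fin 2)
    (hs : ∀ i j, A i j = A j i) (h0 : ∀ i, A i i = 0) : ∑ i, ∑ j, A i j = 0 := by
  rw [← Fintype.sum_prod_type']
  refine Finset.sum_involution (fun p _ => p.swap) ?_ ?_ ?_ ?_
  · rintro ⟨i, j⟩ _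
    simp only [Prod.swap_prod_mk]
    rw [hs j i, add_self_fin]
  · rintro ⟨i, j⟩ _ h heq
    simp only [Prod.swap_prod_mk, Prod.mk.injEq] at heq
    exact h (by rw [heq.1]; exact h0 i)
  · simp
  · simp

/-- The boundary of a chain of cubes is a cycle. -/
lemma parity_edgeCheck_boundary (ht : ∀ i, unitStep n c i ≠ 0) (y : TorusCell n c 3 → Fin 2)
    (e : TorusCell n c 1) : parity (edgeCheck e) (boundary y) = 0 := by
  obtain ⟨v, E, hE⟩ := e
  let Y : TorusVertex n c → Fin n → Fin n → Fin 2 := fun w i j =>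
    extChain y w (insert j (insert i E))
  have hY : ∀ w i j, Y w i j = Y w j i := fun w i j => by
    simp only [Y, Finset.insert_comm]
  let A : Fin n → Fin n → Fin 2 := fun i j => if i ∈ E ∨ j ∈ E ∨ i = j then 0 else
    (Y v i j + Y (v - unitStep n c j) i j) +
      (Y (v - unitStep n c i) i j + Y (v - unitStep n c i - unitStep n c j) i j)
  have hb : ∀ w i, i ∉ E → extChain (boundary y) w (insert i E) =
      ∑ j, if j ∈ E ∨ i = j then 0 else Y w i j + Y (w - unitStep n c j) i j := by
    intro w i hi
    have hcard : (insert i E).card = 2 := by rw [Finset.card_insert_of_notMem hi, hE]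
    rw [extChain_of_card _ _ hcard, boundary, parity_cofacets ht]
    refine Finset.sum_congr rfl fun j _ => ?_
    by_cases hj : j ∈ E ∨ i = j
    · rw [if_pos hj, if_pos]
      rcases hj with hj | rfl
      · exact Finset.mem_insert_of_mem hj
      · exact Finset.mem_insert_self _ _
    · rw [if_neg hj, if_neg]
      intro h
      rcases Finset.mem_insert.1 h with h | h
      · exact hj (Or.inr h.symm)
      · exact hj (Or.inl h)
  have hA : parity (edgeCheck (v, ⟨E, hE⟩)) (boundary y) = ∑ i, ∑ j, A i j := by
    refine (parity_cofacets ht (boundary y) (v, ⟨E, hE⟩)).trans ?_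
    refine Finset.sum_congr rfl fun i _ => ?_
    by_cases hi : i ∈ E
    · simp [hi, A]
    · simp only [if_neg hi]
      rw [hb _ i hi, hb _ i hi, ← Finset.sum_add_distrib]
      refine Finset.sum_congr rfl fun j _ => ?_
      by_cases hj : j ∈ E ∨ i = j
      · simp [A, hj]
      · simp [A, hj, hi]
  rw [hA]
  refine sum_eq_zero_of_symm A (fun i j => ?_) (fun i => by simp [A])
  by_cases h : i ∈ E ∨ j ∈ E ∨ i = j
  · have h' : j ∈ E ∨ i ∈ E ∨ j = i := by tauto
    simp only [A, if_pos h, if_pos h']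
  · have h' : ¬ (j ∈ E ∨ i ∈ E ∨ j = i) := by tauto
    simp only [A, if_neg h, if_neg h', hY _ i j]
    rw [sub_right_comm]
    abel

/-- A chain of cubes that fills the cycle `x` if all the sums of `x` over parallel faces vanish: it
inverts `1 + S` (with `S` the shift in the last direction) on the chains of vanishing sum. -/
noncomputable def filling (hn : 5 ≤ n) (x : TorusCell n c 2 → Fin 2) (g : TorusCell n c 3) :
    Fin 2 :=
  if (⟨n - 1, by omega⟩ : Fin n) ∈ g.2.1 then ∑ j ∈ Finset.range n,
    extChain x (g.1 - (2 * j + 1) • unitStep n c ⟨n - 1, by omega⟩)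
      (g.2.1.erase ⟨n - 1, by omega⟩) else 0

lemma boundary_filling (hn : 5 ≤ n) (ht : ∀ i, unitStep n c i ≠ 0) (x : TorusCell n c 2 → Fin 2)
    (hx : ∀ e, parity (edgeCheck e) x = 0) (hs : ∀ D, ∑ v, x (v, D) = 0) :
    boundary (filling hn x) = x := by
  ext1 f
  obtain ⟨v, D, hD⟩ := f
  have hX := fun w => extChain_of_card x w hD
  have hodd := sum_odd_shift hn (fun w => extChain x w D) v
  simp only [hX, hs ⟨D, hD⟩, add_zero] at hodd
  simp only [← hX] at hodd
  rw [← hX, ← hodd, boundary, parity_cofacets ht]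
  have hfill : ∀ w i, i ∉ D → extChain (filling hn x) w (insert i D) =
      if (⟨n - 1, by omega⟩ : Fin n) ∈ insert i D then ∑ j ∈ Finset.range n,
        extChain x (w - (2 * j + 1) • unitStep n c ⟨n - 1, by omega⟩)
          ((insert i D).erase ⟨n - 1, by omega⟩) else 0 := fun w i hi =>
    extChain_of_card _ _ (by rw [Finset.card_insert_of_notMem hi, hD])
  generalize (⟨n - 1, by omega⟩ : Fin n) = l at hodd hfill ⊢
  by_cases hl : l ∈ D
  · have hE : (D.erase l).card = 1 := by rw [Finset.card_erase_of_mem hl, hD]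
    -- the cycle condition, solved for the faces with the direction `l`
    have hcyc : ∀ w, ∑ i, (if i ∈ D then 0 else extChain x w (insert i (D.erase l)) +
        extChain x (w - unitStep n c i) (insert i (D.erase l))) =
        extChain x w D + extChain x (w - unitStep n c l) D := by
      intro w
      have h : ∑ i, (if i ∈ D.erase l then 0 else extChain x w (insert i (D.erase l)) +
          extChain x (w - unitStep n c i) (insert i (D.erase l))) = 0 :=
        (parity_cofacets ht x (w, ⟨D.erase l, hE⟩)).symm.trans (hx _)
      rw [← Finset.add_sum_erase _ _ (Finset.mem_univ l)] at h ⊢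
      rw [if_neg (Finset.notMem_erase _ _), Finset.insert_erase hl] at h
      rw [if_pos hl, zero_add]
      have h2 : ∑ i ∈ Finset.univ.erase l, (if i ∈ D.erase l then 0 else
          extChain x w (insert i (D.erase l)) +
            extChain x (w - unitStep n c i) (insert i (D.erase l))) =
          ∑ i ∈ Finset.univ.erase l, (if i ∈ D then 0 else
          extChain x w (insert i (D.erase l)) +
            extChain x (w - unitStep n c i) (insert i (D.erase l))) := by
        refine Finset.sum_congr rfl fun i hi => ?_
        simp only [Finset.mem_erase, Finset.ne_of_mem_erase hi, ne_eq, not_false_eq_true, true_and]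
      rw [h2] at h
      generalize extChain x w D + extChain x (w - unitStep n c l) D = a at h ⊢
      exact (eq_neg_of_add_eq_zero_right h).trans (neg_eq_of_add_eq_zero_left (add_self_fin a))
    have hterm : ∀ i, (if i ∈ D then 0 else extChain (filling hn x) v (insert i D) +
        extChain (filling hn x) (v - unitStep n c i) (insert i D)) =
        ∑ j ∈ Finset.range n, if i ∈ D then 0 else
          extChain x (v - (2 * j + 1) • unitStep n c l) (insert i (D.erase l)) +
          extChain x (v - (2 * j + 1) • unitStep n c l - unitStep n c i)
            (insert i (D.erase l)) := by
      intro i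
      by_cases hi : i ∈ D
      · simp [hi]
      · have hil : l ≠ i := fun h => hi (h ▸ hl)
        simp only [if_neg hi, hfill _ i hi, if_pos (Finset.mem_insert_of_mem hl),
          Finset.erase_insert_of_ne hil.symm, ← Finset.sum_add_distrib]
        refine Finset.sum_congr rfl fun j _ => ?_
        rw [sub_right_comm v (unitStep n c i)]
    simp only [hterm]
    rw [Finset.sum_comm]
    refine Finset.sum_congr rfl fun j _ => ?_
    rw [hcyc, sub_right_comm v (unitStep n c l)]
  · rw [Finset.sum_eq_single l]
    · simp only [if_neg hl, hfill _ l hl, if_pos (Finset.mem_insert_self l D),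
        Finset.erase_insert hl, ← Finset.sum_add_distrib]
    · intro i _ hi
      by_cases hiD : i ∈ D
      · rw [if_pos hiD]
      · have : l ∉ insert i D := by
          simp only [Finset.mem_insert, not_or]
          exact ⟨fun h => hi h.symm, hl⟩
        simp only [if_neg hiD, hfill _ i hiD, if_neg this, add_zero]
    · simp

/-- The sums of a chain over the classes of parallel faces. -/
noncomputable def parallelSums (n : ℕ) (c : ℕ → ℤ) :
    (TorusCell n c 2 → Fin 2) →+ (Dirs n 2 → Fin 2) where
  toFun x D := ∑ v, x (v, D)
  map_zero' := by ext D; simp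
  map_add' x y := by ext1 D; simp [Finset.sum_add_distrib]

/-- The second homology group of the torus, with coefficients in `𝔽₂`, is `𝔽₂ ^ C(n,2)`. -/
theorem isHomology_toric (hn : 5 ≤ n) (hc : IsClosePacking n c) :
    IsHomology (Set.range (cubeCheck (n := n) (c := c))) (Set.range edgeCheck)
      (parallelSums n c) where
  even := by
    rintro _ ⟨g, rfl⟩ _ ⟨e, rfl⟩
    rw [ind_cubeCheck]
    exact parity_edgeCheck_boundary (unitStep_ne_zero hn hc) _ e
  vanish := by
    rintro _ ⟨g, rfl⟩
    ext1 D
    change ∑ v, ind (cubeCheck g) (v, D) = 0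
    simp only [ind_cubeCheck, boundary, parity_cofacets (unitStep_ne_zero hn hc)]
    rw [Finset.sum_comm]
    refine Finset.sum_eq_zero fun i _ => ?_
    by_cases hi : i ∈ D.1
    · simp [hi]
    · simp only [if_neg hi]
      have := Equiv.sum_comp (Equiv.subRight (unitStep n c i)) fun v =>
        extChain (Pi.single g 1) v (insert i D.1)
      simp only [Equiv.subRight_apply] at this
      rw [Finset.sum_add_distrib, this, add_self_fin]
  surj := by
    intro φ
    refine ⟨fun f => φ f.2, ?_, ?_⟩
    · rintro _ ⟨e, rfl⟩
      refine (parity_cofacets (unitStep_ne_zero hn hc) _ e).trans (Finset.sum_eq_zero fun i _ => ?_)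
      by_cases hi : i ∈ e.2.1
      · rw [if_pos hi]
      · rw [if_neg hi]
        exact add_self_fin _
    · ext1 D
      change ∑ v : TorusVertex n c, φ D = φ D
      rw [Finset.sum_const, Finset.card_univ, card_torusVertex hn, add_smul, mul_comm, mul_smul,
        two_smul, add_self_fin, smul_zero, zero_add, one_smul]
  exact := by
    intro x hx hs
    rw [← boundary_filling hn (unitStep_ne_zero hn hc) x (fun e => hx _ ⟨e, rfl⟩)
      (fun D => congrFun hs D), boundary_eq_sum]
    refine AddSubgroup.sum_mem _ fun g _ => ?_
    split_ifs
    · exact AddSubgroup.zero_mem _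
    · exact AddSubgroup.subset_closure ⟨_, ⟨g, rfl⟩, rfl⟩

end Homology

/-! ### Syndromes of single errors -/

section Syndromes

lemma parity_ind_singleton {ι : Type} [Fintype ι] (S : Set ι) (f : ι) [Decidable (f ∈ S)] :
    parity S (ind {f}) = if f ∈ S then 1 else 0 := by
  classical
  rw [parity_apply, Finset.sum_eq_single f]
  · simp [Set.indicator_apply, ind]
  · intro b _ hb; simp [Set.indicator_apply, ind, hb]
  · simp

/-- If every qubit is in a check and no two qubits are in the same checks, then at most one error is
determined by its parities. -/
lemma eq_of_parity_eq {ι : Type} [Fintype ι] {Z : Set (Set ι)} (hne : ∀ f, ∃ S ∈ Z, f ∈ S)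
    (hsep : ∀ f f', (∀ S ∈ Z, f ∈ S ↔ f' ∈ S) → f = f') {A A' : Set ι} (hA : A.Subsingleton)
    (hA' : A'.Subsingleton) (h : ∀ S ∈ Z, parity S (ind A) = parity S (ind A')) : A = A' := by
  classical
  have h0 : (ind ∅ : ι → Fin 2) = 0 := Set.indicator_empty _
  rcases hA.eq_empty_or_singleton with rfl | ⟨f, rfl⟩ <;>
    rcases hA'.eq_empty_or_singleton with rfl | ⟨f', rfl⟩
  · rfl
  · obtain ⟨S, hS, hf⟩ := hne f'
    have := h S hS
    simp [parity_ind_singleton, hf, h0] at this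
  · obtain ⟨S, hS, hf⟩ := hne f
    have := h S hS
    simp [parity_ind_singleton, hf, h0] at this
  · rw [hsep f f' fun S hS => ?_]
    have := h S hS
    simp only [parity_ind_singleton] at this
    by_cases h1 : f ∈ S <;> by_cases h2 : f' ∈ S <;> simp_all

variable {n : ℕ} {c : ℕ → ℤ}

lemma exists_edgeCheck (f : TorusCell n c 2) :
    ∃ S ∈ Set.range (edgeCheck (n := n) (c := c)), f ∈ S := by
  obtain ⟨v, D, hD⟩ := f
  obtain ⟨i, hi⟩ : D.Nonempty := Finset.card_pos.1 (by omega)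
  exact ⟨_, ⟨(v, ⟨D.erase i, by rw [Finset.card_erase_of_mem hi, hD]⟩), rfl⟩,
    ⟨i, hi, rfl, Or.inl rfl⟩⟩

/-- A face is determined by its edges. -/
lemma eq_of_edgeCheck_iff (hn : 5 ≤ n) (hc : IsClosePacking n c) (f f' : TorusCell n c 2)
    (h : ∀ S ∈ Set.range (edgeCheck (n := n) (c := c)), f ∈ S ↔ f' ∈ S) : f = f' := by
  replace h : ∀ e : TorusCell n c 1, IsFacet e f ↔ IsFacet e f' := fun e => h _ ⟨e, rfl⟩
  obtain ⟨v, D, hD⟩ := f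
  obtain ⟨v', D', hD'⟩ := f'
  have hcard : ∀ i ∈ D, (D.erase i).card = 1 := fun i hi => by
    rw [Finset.card_erase_of_mem hi, hD]
  have hsub : D ⊆ D' := by
    intro j hj
    obtain ⟨i, hi, hij⟩ := Finset.exists_mem_ne (by omega : 1 < D.card) j
    obtain ⟨i', -, hE, -⟩ := (h (v, ⟨D.erase i, hcard i hi⟩)).1 ⟨i, hi, rfl, Or.inl rfl⟩
    dsimp only at hE
    have : j ∈ D'.erase i' := hE ▸ Finset.mem_erase.2 ⟨hij.symm, hj⟩
    exact Finset.mem_of_mem_erase this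
  obtain rfl : D = D' := Finset.eq_of_subset_of_card_le hsub (by omega)
  obtain ⟨i, hi⟩ : D.Nonempty := Finset.card_pos.1 (by omega)
  have hdir : ∀ i' ∈ D, D.erase i = D.erase i' → i' = i := by
    intro i' hi' hE
    by_contra hne
    exact Finset.notMem_erase i' D (hE ▸ Finset.mem_erase.2 ⟨hne, hi'⟩)
  have h1 : v = v' ∨ v = v' + unitStep n c i := by
    obtain ⟨i', hi', hE, hv⟩ := (h (v, ⟨D.erase i, hcard i hi⟩)).1 ⟨i, hi, rfl, Or.inl rfl⟩
    rwa [hdir i' hi' hE] at hv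
  have h2 : v + unitStep n c i = v' ∨ v + unitStep n c i = v' + unitStep n c i := by
    obtain ⟨i', hi', hE, hv⟩ := (h (v + unitStep n c i, ⟨D.erase i, hcard i hi⟩)).1
      ⟨i, hi, rfl, Or.inr rfl⟩
    rwa [hdir i' hi' hE] at hv
  have : v = v' := by
    rcases h1 with h1 | h1
    · exact h1
    rcases h2 with h2 | h2
    · refine absurd (eq_zero_of_add_self hn ?_) (unitStep_ne_zero hn hc i)
      rw [h1, add_assoc] at h2
      simpa using h2
    · exact add_right_cancel h2
  rw [this]

lemma exists_notMem_of_card {D : Finset (Fin n)} (hD : D.card < n) : ∃ k, k ∉ D := by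
  by_contra! h
  have := Finset.card_le_card (fun k _ => h k : (Finset.univ : Finset (Fin n)) ⊆ D)
  rw [Finset.card_univ, Fintype.card_fin] at this
  omega

lemma exists_cubeCheck (hn : 5 ≤ n) (f : TorusCell n c 2) :
    ∃ S ∈ Set.range (cubeCheck (n := n) (c := c)), f ∈ S := by
  obtain ⟨v, D, hD⟩ := f
  obtain ⟨k, hk⟩ := exists_notMem_of_card (D := D) (by omega)
  exact ⟨_, ⟨(v, ⟨insert k D, by rw [Finset.card_insert_of_notMem hk, hD]⟩), rfl⟩,
    ⟨k, Finset.mem_insert_self k D, (Finset.erase_insert hk).symm, Or.inl rfl⟩⟩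

/-- A face is determined by the cubes that contain it: for two faces there is a direction that
occurs in neither of them. -/
lemma eq_of_cubeCheck_iff (hn : 5 ≤ n) (hc : IsClosePacking n c) (f f' : TorusCell n c 2)
    (h : ∀ S ∈ Set.range (cubeCheck (n := n) (c := c)), f ∈ S ↔ f' ∈ S) : f = f' := by
  replace h : ∀ g : TorusCell n c 3, IsFacet f g ↔ IsFacet f' g := fun g => h _ ⟨g, rfl⟩
  obtain ⟨v, D, hD⟩ := f
  obtain ⟨v', D', hD'⟩ := f'
  obtain ⟨k, hk⟩ := exists_notMem_of_card (D := D ∪ D')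
    (by have := Finset.card_union_le D D'; omega)
  rw [Finset.mem_union, not_or] at hk
  obtain ⟨hk, hk'⟩ := hk
  have hcard : (insert k D).card = 3 := by rw [Finset.card_insert_of_notMem hk, hD]
  have key : ∀ w, (v = w ∨ v = w + unitStep n c k) →
      D' = D ∧ (v' = w ∨ v' = w + unitStep n c k) := by
    intro w hw
    obtain ⟨i, hi, hE, hv⟩ := (h (w, ⟨insert k D, hcard⟩)).1
      ⟨k, Finset.mem_insert_self k D, (Finset.erase_insert hk).symm, hw⟩
    dsimp only at hi hE
    have hik : i = k := by
      by_contra hne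
      exact hk' (hE ▸ Finset.mem_erase.2 ⟨fun h => hne h.symm, Finset.mem_insert_self k D⟩)
    rw [hik, Finset.erase_insert hk] at hE
    rw [hik] at hv
    exact ⟨hE, hv⟩
  obtain ⟨rfl, h1⟩ := key v (Or.inl rfl)
  obtain ⟨-, h2⟩ := key (v - unitStep n c k) (Or.inr (sub_add_cancel _ _).symm)
  rw [sub_add_cancel] at h2
  have : v = v' := by
    rcases h2 with h2 | h2
    · rcases h1 with h1 | h1
      · exact h1.symm
      · refine absurd (eq_zero_of_add_self hn ?_) (unitStep_ne_zero hn hc k)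
        rw [h1, eq_sub_iff_add_eq, add_assoc] at h2
        simpa using h2
    · exact h2.symm
  rw [this]

end Syndromes

/-! ### Copies of a code on disjoint sets of qubits -/

section Copies

variable {M ι ι' : Type} [Fintype M] [Fintype ι] [Fintype ι'] {P : M × ι → ι'}

/-- The checks of one copy of a code for every `m : M`, its qubits moved by `P (m, ·)`. -/
def copies (P : M × ι → ι') (X : Set (Set ι)) : Set (Set ι') :=
  {S | ∃ m, ∃ S₀ ∈ X, S = (fun f => P (m, f)) '' S₀}

lemma parity_image (hP : Function.Bijective P) (m : M) (S : Set ι) (x : ι' → Fin 2) :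
    parity ((fun f => P (m, f)) '' S) x = parity S fun f => x (P (m, f)) := by
  classical
  rw [parity_apply, ← hP.sum_comp, Fintype.sum_prod_type, Finset.sum_eq_single m]
  · refine Finset.sum_congr rfl fun f _ => ?_
    have : P (m, f) ∈ (fun f => P (m, f)) '' S ↔ f ∈ S :=
      ⟨fun ⟨f', hf', h⟩ => by cases hP.1 h; exact hf', fun h => ⟨f, h, rfl⟩⟩
    simp only [Set.indicator_apply, this]
  · intro m' _ hm'
    refine Finset.sum_eq_zero fun f _ => Set.indicator_of_notMem ?_ _
    rintro ⟨f', -, h⟩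
    cases hP.1 h
    exact hm' rfl
  · simp

lemma ind_image_apply (hP : Function.Injective P) (m m' : M) [Decidable (m' = m)] (S : Set ι)
    (f : ι) :
    ind ((fun f => P (m, f)) '' S) (P (m', f)) = if m' = m then ind S f else 0 := by
  classical
  by_cases h : m' = m
  · subst h
    have : P (m', f) ∈ (fun f => P (m', f)) '' S ↔ f ∈ S :=
      ⟨fun ⟨f', hf', h⟩ => by cases hP h; exact hf', fun h => ⟨f, h, rfl⟩⟩
    simp only [ind, Set.indicator_apply, this, if_true, Pi.one_apply]
  · rw [if_neg h]
    refine Set.indicator_of_notMem ?_ _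
    rintro ⟨f', -, h'⟩
    cases hP h'
    exact h rfl

open Classical in
/-- The chain on the copy `m`, extended by zero to the other copies. -/
noncomputable def embedCopy (hP : Function.Bijective P) (m : M) :
    (ι → Fin 2) →+ (ι' → Fin 2) where
  toFun u i := if ((Equiv.ofBijective P hP).symm i).1 = m
    then u ((Equiv.ofBijective P hP).symm i).2 else 0
  map_zero' := by ext1 i; simp
  map_add' u v := by ext1 i; simp only [Pi.add_apply]; split_ifs <;> simp

open Classical in
lemma embedCopy_apply (hP : Function.Bijective P) (m m' : M) (u : ι → Fin 2) (f : ι) :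
    embedCopy hP m u (P (m', f)) = if m' = m then u f else 0 := by
  have : (Equiv.ofBijective P hP).symm (P (m', f)) = (m', f) :=
    (Equiv.ofBijective P hP).symm_apply_apply (m', f)
  simp [embedCopy, this]

/-- The homology map of each copy. -/
def copiesMap {H : Type*} [AddCommGroup H] (P : M × ι → ι') (π : (ι → Fin 2) →+ H) :
    (ι' → Fin 2) →+ (M → H) where
  toFun x m := π fun f => x (P (m, f))
  map_zero' := by ext1 m; exact map_zero π
  map_add' x y := by ext1 m; exact map_add π _ _

theorem IsHomology.copies {X Z : Set (Set ι)} {H : Type*} [AddCommGroup H]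
    {π : (ι → Fin 2) →+ H} (h : IsHomology X Z π) (hP : Function.Bijective P) :
    IsHomology (copies P X) (copies P Z) (copiesMap P π) where
  even := by
    classical
    rintro _ ⟨m, S, hS, rfl⟩ _ ⟨m', S', hS', rfl⟩
    rw [parity_image hP]
    by_cases hm : m' = m
    · simp only [ind_image_apply hP.1, hm, if_true]
      exact h.even S hS S' hS'
    · simp only [ind_image_apply hP.1, hm, if_false]
      exact map_zero _
  vanish := by
    classical
    rintro _ ⟨m, S, hS, rfl⟩
    ext1 m'
    change π _ = 0
    by_cases hm : m' = m
    · simp only [ind_image_apply hP.1, hm, if_true]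
      exact h.vanish S hS
    · simp only [ind_image_apply hP.1, hm, if_false]
      exact map_zero _
  surj := by
    intro φ
    choose y hy hy' using h.surj
    let e := Equiv.ofBijective P hP
    let x : ι' → Fin 2 := fun i => y (φ (e.symm i).1) (e.symm i).2
    have hx : ∀ m, (fun f => x (P (m, f))) = y (φ m) := by
      intro m
      ext1 f
      have : e.symm (P (m, f)) = (m, f) := e.symm_apply_apply (m, f)
      simp only [x, this]
    refine ⟨x, ?_, ?_⟩
    · rintro _ ⟨m, S, hS, rfl⟩
      rw [parity_image hP, hx]
      exact hy _ S hS
    · ext1 m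
      change π _ = _
      rw [hx, hy']
  exact := by
    classical
    intro x hx hπ
    have hsum : x = ∑ m, embedCopy hP m fun f => x (P (m, f)) := by
      ext1 i
      obtain ⟨⟨m, f⟩, rfl⟩ := hP.2 i
      rw [Finset.sum_apply]
      simp [embedCopy_apply]
    rw [hsum]
    refine AddSubgroup.sum_mem _ fun m _ => ?_
    have hmem : (fun f => x (P (m, f))) ∈ AddSubgroup.closure (ind '' X) :=
      h.exact _ (fun S hS => by rw [← parity_image hP]; exact hx _ ⟨m, S, hS, rfl⟩)
        (congrFun hπ m)
    have hle : AddSubgroup.closure (ind '' X) ≤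
        (AddSubgroup.closure (ind '' ToricInterleaving.copies P X)).comap (embedCopy hP m) := by
      rw [AddSubgroup.closure_le]
      rintro _ ⟨S, hS, rfl⟩
      refine AddSubgroup.subset_closure ⟨_, ⟨m, S, hS, rfl⟩, ?_⟩
      ext1 i
      obtain ⟨⟨m', f⟩, rfl⟩ := hP.2 i
      rw [ind_image_apply hP.1, embedCopy_apply]
    exact hle hmem

/-- At most one error in each copy is determined by the parities, if this holds for one copy. -/
lemma eq_of_parity_eq_copies (hP : Function.Bijective P) {Z : Set (Set ι)}
    (hne : ∀ f, ∃ S ∈ Z, f ∈ S) (hsep : ∀ f f', (∀ S ∈ Z, f ∈ S ↔ f' ∈ S) → f = f')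
    {A A' : Set ι'} (hA : ∀ m, {f | P (m, f) ∈ A}.Subsingleton)
    (hA' : ∀ m, {f | P (m, f) ∈ A'}.Subsingleton)
    (h : ∀ S ∈ copies P Z, parity S (ind A) = parity S (ind A')) : A = A' := by
  have hslice : ∀ m, {f | P (m, f) ∈ A} = {f | P (m, f) ∈ A'} := fun m =>
    eq_of_parity_eq hne hsep (hA m) (hA' m) fun S hS => by
      have := h _ ⟨m, S, hS, rfl⟩
      rw [parity_image hP, parity_image hP] at this
      exact this
  ext i
  obtain ⟨⟨m, f⟩, rfl⟩ := hP.2 i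
  exact Set.ext_iff.1 (hslice m) f

end Copies

/-! ### The interleaving is a bijection -/

section Place

variable {n : ℕ} {c : ℕ → ℤ}

theorem nonempty_interleaving (hn : 5 ≤ n) (hc : IsClosePacking n c) :
    Nonempty (Interleaving n c) := by
  have hq : Nonempty (Fin (n.choose 2) × Fin (2 * n + 1) ≃ TorusCell n c 2) := by
    rw [← Fintype.card_eq]
    simp only [Fintype.card_prod, Fintype.card_fin, card_torusVertex hn, card_dirs]
    exact mul_comm _ _
  have hs : Nonempty (Fin (2 * n + 1) ≃ LeeSphere n) := by
    rw [← Fintype.card_eq, ← Nat.card_eq_fintype_card, ← Nat.card_eq_fintype_card,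
      card_leeSphere hn hc, Nat.card_fin]
  have hf : Nonempty (Fin (n.choose 2) ≃ Dirs n 2) := by
    rw [← Fintype.card_eq, card_dirs, Fintype.card_fin]
  obtain ⟨q⟩ := hq
  obtain ⟨s⟩ := hs
  obtain ⟨f⟩ := hf
  exact ⟨fun _ => q,
    fun _ => s.trans (Equiv.swap (s 0) ⟨0, by rw [mannheimWeight_zero]; omega⟩),
    fun _ => by simp, fun _ => f⟩

/-- The number of the codeword whose Lee sphere receives the qubit `p`. -/
def Interleaving.host (I : Interleaving n c)
    (p : Fin ((2 * n + 1) ^ (n - 1)) × TorusCell n c 2) : ℕ :=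
  (p.1 : ℕ) / (2 * n + 1) ^ (n - 2) * (2 * n + 1) ^ (n - 2) +
    ((p.1 : ℕ) % (2 * n + 1) ^ (n - 2) % (2 * n + 1) ^ (n - 3) * (2 * n + 1) +
      ((I.qubit p.1).symm p.2).2)

/-- The hypercube, relative to the centre of its Lee sphere, that receives the qubits of the
codeword number `m`. -/
def Interleaving.offset (I : Interleaving n c) (m : ℕ) : LeeSphere n :=
  I.cube (Fin.ofNat (2 * n + 1) (m / (2 * n + 1) ^ (n - 2)))
    (Fin.ofNat (2 * n + 1) (m % (2 * n + 1) ^ (n - 2) / (2 * n + 1) ^ (n - 3)))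

variable (I : Interleaving n c) (p p' : Fin ((2 * n + 1) ^ (n - 1)) × TorusCell n c 2)

lemma Interleaving.place_fst : (I.place p).1 = codeword n c (I.host p) + (I.offset p.1).1 := rfl

lemma Interleaving.place_snd :
    (I.place p).2 = I.face (I.place p).1 ((I.qubit p.1).symm p.2).1 := rfl

lemma pow_pred_eq (hn : 5 ≤ n) : (2 * n + 1) ^ (n - 2) = (2 * n + 1) * (2 * n + 1) ^ (n - 3) := by
  rw [← pow_succ', show n - 3 + 1 = n - 2 by omega]

lemma Interleaving.host_remainder_lt (hn : 5 ≤ n) :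
    (p.1 : ℕ) % (2 * n + 1) ^ (n - 2) % (2 * n + 1) ^ (n - 3) * (2 * n + 1) +
      (((I.qubit p.1).symm p.2).2 : ℕ) < (2 * n + 1) ^ (n - 2) := by
  have h1 := Nat.mod_lt ((p.1 : ℕ) % (2 * n + 1) ^ (n - 2))
    (show 0 < (2 * n + 1) ^ (n - 3) by positivity)
  have h2 := ((I.qubit p.1).symm p.2).2.2
  rw [pow_pred_eq hn] at h1 ⊢
  nlinarith

lemma Interleaving.host_div (hn : 5 ≤ n) :
    I.host p / (2 * n + 1) ^ (n - 2) = (p.1 : ℕ) / (2 * n + 1) ^ (n - 2) := by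
  rw [host, mul_comm, Nat.mul_add_div (by positivity),
    Nat.div_eq_of_lt (I.host_remainder_lt p hn), add_zero]

lemma div_pow_lt (hn : 5 ≤ n) {m : ℕ} (hm : m < (2 * n + 1) ^ (n - 1)) :
    m / (2 * n + 1) ^ (n - 2) < 2 * n + 1 := by
  rw [Nat.div_lt_iff_lt_mul (by positivity), ← pow_succ', show n - 2 + 1 = n - 1 by omega]
  exact hm

lemma Interleaving.host_lt (hn : 5 ≤ n) : I.host p < (2 * n + 1) ^ (n - 1) := by
  have h := div_pow_lt hn p.1.2
  rw [← I.host_div p hn, Nat.div_lt_iff_lt_mul (by positivity), ← pow_succ',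
    show n - 2 + 1 = n - 1 by omega] at h
  exact h

lemma Interleaving.near_host : mannheimWeight ((I.place p).1 - codeword n c (I.host p)) ≤ 1 := by
  rw [I.place_fst, add_sub_cancel_left]
  exact (I.offset p.1).2

lemma Interleaving.host_eq (hn : 5 ≤ n) (hc : IsClosePacking n c)
    (h : (I.place p).1 = (I.place p').1) : I.host p = I.host p' :=
  (codeword_bijOn hn).injOn (I.host_lt p hn) (I.host_lt p' hn)
    (hc.eq_of_near (codeword_mem _) (codeword_mem _) (I.near_host p) (h ▸ I.near_host p'))

theorem Interleaving.place_injective (hn : 5 ≤ n) (hc : IsClosePacking n c) :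
    Function.Injective I.place := by
  intro p p' h
  have h1 : (I.place p).1 = (I.place p').1 := congrArg Prod.fst h
  have hhost := I.host_eq p p' hn hc h1
  have hdiv := (I.host_div p hn).symm.trans ((congrArg (· / _) hhost).trans (I.host_div p' hn))
  -- the last digits of the host give the position in the block and the place in the group of `q`
  have hlow : (p.1 : ℕ) % (2 * n + 1) ^ (n - 2) % (2 * n + 1) ^ (n - 3) * (2 * n + 1) +
      (((I.qubit p.1).symm p.2).2 : ℕ) =
      (p'.1 : ℕ) % (2 * n + 1) ^ (n - 2) % (2 * n + 1) ^ (n - 3) * (2 * n + 1) +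
      (((I.qubit p'.1).symm p'.2).2 : ℕ) := by
    have := hhost
    unfold host at this
    rw [hdiv] at this
    exact Nat.add_left_cancel this
  have hs : (((I.qubit p.1).symm p.2).2 : ℕ) = ((I.qubit p'.1).symm p'.2).2 := by
    have := congrArg (· % (2 * n + 1)) hlow
    simp only [Nat.mul_add_mod_self_right] at this
    rwa [Nat.mod_eq_of_lt (Fin.is_lt _), Nat.mod_eq_of_lt (Fin.is_lt _)] at this
  have hu : (p.1 : ℕ) % (2 * n + 1) ^ (n - 2) % (2 * n + 1) ^ (n - 3) =
      (p'.1 : ℕ) % (2 * n + 1) ^ (n - 2) % (2 * n + 1) ^ (n - 3) := by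
    rw [hs] at hlow
    exact Nat.eq_of_mul_eq_mul_right (by omega) (Nat.add_right_cancel hlow)
  have hoff : I.offset p.1 = I.offset p'.1 := by
    rw [I.place_fst, I.place_fst, hhost] at h1
    exact Subtype.ext (add_left_cancel h1)
  have hb : (p.1 : ℕ) % (2 * n + 1) ^ (n - 2) / (2 * n + 1) ^ (n - 3) =
      (p'.1 : ℕ) % (2 * n + 1) ^ (n - 2) / (2 * n + 1) ^ (n - 3) := by
    unfold offset at hoff
    rw [hdiv] at hoff
    have hlt : ∀ m : ℕ, m % (2 * n + 1) ^ (n - 2) / (2 * n + 1) ^ (n - 3) < 2 * n + 1 := by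
      intro m
      rw [Nat.div_lt_iff_lt_mul (by positivity), ← pow_pred_eq hn]
      exact Nat.mod_lt _ (by positivity)
    have := congrArg Fin.val ((I.cube _).injective hoff)
    simpa only [Fin.val_ofNat, Nat.mod_eq_of_lt (hlt _)] using this
  have hm : p.1 = p'.1 := by
    refine Fin.ext ?_
    rw [← Nat.div_add_mod (p.1 : ℕ) ((2 * n + 1) ^ (n - 2)),
      ← Nat.div_add_mod (p'.1 : ℕ) ((2 * n + 1) ^ (n - 2)), hdiv,
      ← Nat.div_add_mod ((p.1 : ℕ) % (2 * n + 1) ^ (n - 2)) ((2 * n + 1) ^ (n - 3)),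
      ← Nat.div_add_mod ((p'.1 : ℕ) % (2 * n + 1) ^ (n - 2)) ((2 * n + 1) ^ (n - 3)), hb, hu]
  have ha : ((I.qubit p.1).symm p.2).1 = ((I.qubit p'.1).symm p'.2).1 := by
    have h2 : (I.place p).2 = (I.place p').2 := congrArg Prod.snd h
    rw [I.place_snd, I.place_snd, h1] at h2
    exact (I.face _).injective h2
  obtain ⟨m, f⟩ := p
  obtain ⟨m', f'⟩ := p'
  obtain rfl : m = m' := hm
  exact congrArg (Prod.mk m) ((I.qubit m).symm.injective (Prod.ext ha (Fin.ext hs)))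

lemma card_latticeFace : Fintype.card (LatticeFace n) = n.choose 2 * (2 * n + 1) ^ n := by
  simp only [Fintype.card_prod, card_dirs, Fintype.card_fun, ZMod.card, Fintype.card_fin]
  exact mul_comm _ _

theorem Interleaving.place_bijective (hn : 5 ≤ n) (hc : IsClosePacking n c) :
    Function.Bijective I.place := by
  rw [Fintype.bijective_iff_injective_and_card]
  refine ⟨I.place_injective hn hc, ?_⟩
  rw [card_latticeFace]
  simp only [Fintype.card_prod, card_dirs, Fintype.card_fin, card_torusVertex hn]
  rw [← mul_assoc, ← pow_succ, show n - 1 + 1 = n by omega, mul_comm]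

lemma Interleaving.code_eq : I.code = stabilizerCode
    (copies I.place (Set.range cubeCheck)) (copies I.place (Set.range edgeCheck)) := by
  have h : ∀ {l : ℕ} (F : TorusCell n c l → Set (TorusCell n c 2)),
      {S | ∃ m g, S = (fun f => I.place (m, f)) '' F g} = copies I.place (Set.range F) := by
    intro l F
    ext S
    simp only [copies, Set.exists_range_iff]
  rw [code, h, h]

end Place

/-! ### Bursts -/

section Bursts

variable {n : ℕ} {c : ℕ → ℤ}

/-- A Lee sphere contained in the region of a cross-section is centred at a codeword of this
cross-section: its extreme points in the first direction lie in the region only if they are extreme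
points of the spheres of the codewords. -/
lemma center_mem (hn : 5 ≤ n) {j : ZMod (2 * n + 1)} {z : Site n}
    (h : ∀ x, mannheimWeight (x - z) ≤ 1 → x ∈ sectionRegion n c j) :
    z ∈ latticeCode n c ∧ ∀ i : Fin n, (i : ℕ) = 0 → z i = j := by
  have hsmall : ∀ k : ℕ, 0 < k → k < 5 → (k : ZMod (2 * n + 1)) ≠ 0 := by
    intro k hk hk5 h0
    have := Nat.le_of_dvd hk ((ZMod.natCast_eq_zero_iff k (2 * n + 1)).1 h0)
    omega
  have h1 := hsmall 1 (by omega) (by omega)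
  have h2 := hsmall 2 (by omega) (by omega)
  have h3 := hsmall 3 (by omega) (by omega)
  have h4 := hsmall 4 (by omega) (by omega)
  push_cast at h1 h2 h3 h4
  let o : Fin n := ⟨0, by omega⟩
  have hval : ∀ y : Site n, mannheimWeight y ≤ 1 →
      (y o = 1 ∧ y = Pi.single o 1) ∨ y o = 0 ∨ y o = -1 := by
    intro y hy
    rcases (mannheimWeight_le_one_iff hn).1 hy with rfl | ⟨i, t, ht, rfl⟩
    · exact Or.inr (Or.inl rfl)
    · by_cases hi : i = o
      · subst hi
        rcases ht with rfl | rfl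
        · exact Or.inl ⟨Pi.single_eq_same _ _, rfl⟩
        · exact Or.inr (Or.inr (Pi.single_eq_same _ _))
      · exact Or.inr (Or.inl (Pi.single_eq_of_ne (Ne.symm hi) _))
  obtain ⟨w, hw, hwj, hwz⟩ := h (z + Pi.single o 1)
    (by rw [add_sub_cancel_left, mannheimWeight_single_one hn])
  obtain ⟨w', -, hwj', hwz'⟩ := h (z + Pi.single o (-1))
    (by rw [add_sub_cancel_left, mannheimWeight_single_neg_one hn])
  have hdiff : (z + Pi.single o 1 - w : Site n) o - (z + Pi.single o (-1) - w' : Site n) o = 2 := by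
    simp only [Pi.add_apply, Pi.sub_apply, Pi.single_eq_same, hwj o rfl, hwj' o rfl]
    ring
  have hzw : z = w := by
    rcases hval _ hwz with ⟨-, ha⟩ | ha
    · rw [add_sub_right_comm, add_eq_right, sub_eq_zero] at ha
      exact ha
    · exfalso
      rcases ha with ha | ha <;> rcases hval _ hwz' with ⟨hb, -⟩ | hb | hb <;>
        rw [ha, hb] at hdiff
      · exact h3 (by linear_combination -hdiff)
      · exact h2 (by linear_combination -hdiff)
      · exact h1 (by linear_combination -hdiff)
      · exact h4 (by linear_combination -hdiff)
      · exact h3 (by linear_combination -hdiff)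
      · exact h2 (by linear_combination -hdiff)
  rw [hzw]
  exact ⟨hw, hwj⟩

/-- A burst hits every copy of the toric code at most once: the qubits of a copy lie in the spheres
of distinct codewords of one cross-section, at the same place of these spheres. -/
lemma IsBurst.subsingleton (hn : 5 ≤ n) (hc : IsClosePacking n c) (I : Interleaving n c)
    {T : Set (LatticeFace n)} (hT : IsBurst n c T) (m : Fin ((2 * n + 1) ^ (n - 1))) :
    {f | I.place (m, f) ∈ T}.Subsingleton := by
  obtain ⟨center, hreg, hcov, hone⟩ := hT
  have hhost : ∀ f, I.place (m, f) ∈ T → codeword n c (I.host (m, f)) =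
      center (((m : ℕ) / (2 * n + 1) ^ (n - 2) : ℕ) : ZMod (2 * n + 1)) := by
    intro f hf
    obtain ⟨j, hj⟩ := hcov _ hf
    obtain ⟨hmem, hfirst⟩ := center_mem hn (hreg j)
    have heq := hc.eq_of_near (codeword_mem _) hmem (I.near_host (m, f)) hj
    have h0 := codeword_first hn (c := c) (I.host_lt (m, f) hn) ⟨0, by omega⟩ rfl
    rw [heq, hfirst _ rfl, I.host_div _ hn] at h0
    rw [heq, h0]
  intro f hf f' hf'
  have hEq : I.host (m, f) = I.host (m, f') := (codeword_bijOn hn).injOn (I.host_lt _ hn)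
    (I.host_lt _ hn) ((hhost f hf).trans (hhost f' hf').symm)
  have hplace := hone _ hf _ hf' (by rw [I.place_fst, I.place_fst, hEq])
  exact (Prod.ext_iff.1 (I.place_injective hn hc hplace)).2

theorem isGreatest_burst (hn : 5 ≤ n) (hc : IsClosePacking n c) :
    IsGreatest {t | ∃ T, IsBurst n c T ∧ t = T.ncard} ((2 * n + 1) ^ 2) := by
  have hcard : Nat.card (ZMod (2 * n + 1) × LeeSphere n) = (2 * n + 1) ^ 2 := by
    rw [Nat.card_prod, Nat.card_zmod, card_leeSphere hn hc, sq]
  constructor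
  · obtain ⟨D⟩ : Nonempty (Dirs n 2) := by
      rw [← Fintype.card_pos_iff, card_dirs]
      exact Nat.choose_pos (by omega)
    let center : ZMod (2 * n + 1) → Site n := fun j => j.val • reduce n (vLast n)
    have hmem : ∀ j, center j ∈ latticeCode n c := fun j =>
      AddSubgroup.nsmul_mem _ ((mem_latticeCode_iff hn).2 (dual_vLast hn)) _
    have hfirst : ∀ j (i : Fin n), (i : ℕ) = 0 → center j i = j := by
      intro j i hi
      change j.val • ((vLast n i : ℤ) : ZMod (2 * n + 1)) = j
      rw [vLast, if_pos hi, Int.cast_one, nsmul_one, ZMod.natCast_zmod_val]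
    let F : ZMod (2 * n + 1) × LeeSphere n → LatticeFace n := fun p => (center p.1 + p.2.1, D)
    have hF : Function.Injective F := by
      rintro ⟨j, y⟩ ⟨j', y'⟩ h
      have h1 : center j + y.1 = center j' + y'.1 := congrArg Prod.fst h
      have h2 : center j = center j' := hc.eq_of_near (x := center j + y.1) (hmem j) (hmem j')
        (by rw [add_sub_cancel_left]; exact y.2)
        (by rw [h1, add_sub_cancel_left]; exact y'.2)
      have h3 : j = j' := by
        rw [← hfirst j ⟨0, by omega⟩ rfl, h2, hfirst j' ⟨0, by omega⟩ rfl]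
      rw [h2] at h1
      rw [h3, Subtype.ext (add_left_cancel h1)]
    refine ⟨Set.range F, ⟨center, fun j x hx => ⟨center j, hmem j, hfirst j, hx⟩, ?_, ?_⟩, ?_⟩
    · rintro _ ⟨p, rfl⟩
      exact ⟨p.1, by simp only [F]; rw [add_sub_cancel_left]; exact p.2.2⟩
    · rintro _ ⟨p, rfl⟩ _ ⟨p', rfl⟩ h
      exact Prod.ext h rfl
    · rw [← hcard, ← Nat.card_range_of_injective hF]
      rfl
  · rintro _ ⟨T, ⟨center, -, hcov, hone⟩, rfl⟩
    choose j hj using hcov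
    rw [← hcard]
    refine Nat.card_le_card_of_injective
      (fun f : T => (j f.1 f.2, (⟨f.1.1 - center (j f.1 f.2), hj f.1 f.2⟩ : LeeSphere n))) ?_
    rintro ⟨f, hf⟩ ⟨f', hf'⟩ h
    obtain ⟨h1, h2⟩ := Prod.ext_iff.1 h
    dsimp only at h1 h2
    have h3 := congrArg Subtype.val h2
    dsimp only at h3
    rw [h1] at h3
    exact Subtype.ext (hone f hf f' hf' (sub_left_injective h3))

end Bursts

end ToricInterleaving

open ToricInterleaving
theorem theorem3 (n : ℕ) (hn : 5 ≤ n) :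
    IsClosePacking n (standardLast n) ∧
    ∀ c : ℕ → ℤ, IsClosePacking n c →
      -- the toric quantum code, with parameters `[[C(n,2) q, C(n,2), 3]]`
      (Fintype.card (TorusCell n c 2) = n.choose 2 * (2 * n + 1) ∧
        Module.finrank ℂ (toricCode n c) = 2 ^ n.choose 2 ∧
        IsLeast {d | ∃ w ∈ latticeCode n c, w ≠ 0 ∧ d = mannheimWeight w} 3 ∧
        Corrects (toricCode n c) {T | T.ncard ≤ 1}) ∧
      -- it has one copy for each codeword, and the interleaving method can be carried out
      (Nat.card (latticeCode n c) = (2 * n + 1) ^ (n - 1) ∧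
        Set.BijOn (codeword n c) (Set.Iio ((2 * n + 1) ^ (n - 1))) (latticeCode n c) ∧
        Nonempty (Interleaving n c)) ∧
      -- the interleaved code, with parameters `[[C(n,2) q ^ n, C(n,2) q ^ (n - 1), q ^ 2]]`
      (∀ I : Interleaving n c,
        Function.Bijective I.place ∧
        Fintype.card (LatticeFace n) = n.choose 2 * (2 * n + 1) ^ n ∧
        Module.finrank ℂ I.code = 2 ^ (n.choose 2 * (2 * n + 1) ^ (n - 1)) ∧
        Corrects I.code {T | IsBurst n c T}) ∧
      -- bursts have up to `q ^ 2` errors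
      IsGreatest {t | ∃ T, IsBurst n c T ∧ t = T.ncard} ((2 * n + 1) ^ 2) := by
  refine ⟨isClosePacking_standard hn, fun c hc => ⟨⟨?_, ?_, isLeast_mannheimWeight hn hc, ?_⟩,
    ⟨card_latticeCode hn, codeword_bijOn hn, nonempty_interleaving hn hc⟩, fun I =>
    ⟨I.place_bijective hn hc, card_latticeFace, ?_, ?_⟩, isGreatest_burst hn hc⟩⟩
  · rw [Fintype.card_prod, card_dirs, card_torusVertex hn, mul_comm]
  · rw [toricCode, (isHomology_toric hn hc).finrank_eq, Fintype.card_fun, card_dirs,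
      Fintype.card_fin]
  · have hsub : ∀ {T A : Set (TorusCell n c 2)}, T.ncard ≤ 1 → A ⊆ T → A.Subsingleton :=
      fun hT hA => ((Set.ncard_le_one_iff_subsingleton).1 hT).anti hA
    exact corrects_of_syndrome
      (fun T hT T' hT' A hA A' hA' => eq_of_parity_eq exists_edgeCheck (eq_of_edgeCheck_iff hn hc)
        (hsub hT hA) (hsub hT' hA'))
      (fun T hT T' hT' A hA A' hA' => eq_of_parity_eq (exists_cubeCheck hn)
        (eq_of_cubeCheck_iff hn hc) (hsub hT hA) (hsub hT' hA'))
  · rw [I.code_eq, ((isHomology_toric hn hc).copies (I.place_bijective hn hc)).finrank_eq,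
      Fintype.card_fun, Fintype.card_fun, card_dirs, Fintype.card_fin, Fintype.card_fin, pow_mul]
  · have hsub : ∀ {T A : Set (LatticeFace n)}, IsBurst n c T → A ⊆ T →
        ∀ m, {f | I.place (m, f) ∈ A}.Subsingleton :=
      fun hT hA m => (hT.subsingleton hn hc I m).anti fun _ hf => hA hf
    rw [I.code_eq]
    exact corrects_of_syndrome
      (fun T hT T' hT' A hA A' hA' => eq_of_parity_eq_copies (I.place_bijective hn hc)
        exists_edgeCheck (eq_of_edgeCheck_iff hn hc) (hsub hT hA) (hsub hT' hA'))
      (fun T hT T' hT' A hA A' hA' => eq_of_parity_eq_copies (I.place_bijective hn hc)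
        (exists_cubeCheck hn) (eq_of_cubeCheck_iff hn hc) (hsub hT hA) (hsub hT' hA'))
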